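/- Let $d\ge 1$ and $\nu\ge 0$ be integers and $\Omega=[-1,1]^d$. Functions on $\Omega$ with periodic boundary conditions are identified with functions on $\mathbb R^d$ that are $2$-periodic in each coordinate. Let $\mathcal C_p^{\nu,1}(\Omega)$ be the set of such functions $f:\mathbb R^d\to\mathbb R$ that are $\nu$ times continuously differentiable, whose partial derivatives of order $\nu$ are Lipschitz, and with $$\|f\|_{\mathcal C^{\nu,1}}:=\max_{|\alpha|\le \nu+1}\|D^\alpha f\|_{L^\infty(\Omega)}<\infty ,$$ where the derivatives of order $\nu+1$ exist almost everywhere. For periodic $g,f$ put $(g*f)(x)=\int_\Omega g(y)f(x-y)\,dy$, where $dy$ is Lebesgue measure. For $n\in\mathbb Z$ let $\mathrm{soc}(n,z)$ be $1$ if $n=0$, $\sin(n\pi z)$ if $n>0$, and $\cos(n\pi z)$ if $n<0$. Let $\mathbb T_N$ be the space of trigonometric polynomials of degree at most $N$, that is, of all functions $z\mapsto\sum_{n\in\mathbb Z^d,\ \|n\|_1\le N}\theta_n\prod_{i=1}^d\mathrm{soc}(n_i,z_i)$ with $\theta_n\in\mathbb R$. Let $$D_n^0(z)=2^{-d}\sum_{k\in\mathbb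 Z^d,\ \|k\|_1\le n}e^{i\pi k\cdot z}$$ be the Dirichlet kernel, so that $D_n^0*f$ is the Fourier series of $f$ truncated to $\|k\|_1\le n$, and for every positive even integer $N$ let $$D_N=\frac1{N/2+1}\sum_{n=N/2}^{N}D_n^0$$ be the de la Vallée-Poussin kernel. **Theorem.** There is a constant $\Lambda_d$, depending only on $d$, with $\|D_N\|_{L^1(\Omega)}\le\Lambda_d$ for every positive even $N$. Moreover there is a constant $K>0$, depending only on $d$ and $\nu$, such that for every such $\Lambda_d$, every positive even integer $N$ and every $f\in\mathcal C_p^{\nu,1}(\Omega)$ one has $D_N*f\in\mathbb T_N$ and $$\|f-D_N*f\|_{L^\infty(\Omega)}\le 2\Lambda_d\inf_{t\in\mathbb T_{N/2}}\|t-f\|_{L^\infty(\Omega)}\le\frac{2^{\nu+2}\Lambda_dK}{N^{\nu+1}}\|f\|_{\mathcal C^{\nu,1}} .$$ -/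

import Mathlib

open scoped ENNReal NNReal

noncomputable section

namespace TrigApprox

/-- The cube `Ω = [-1,1]^d`, carrying Lebesgue measure. -/
def cube (d : ℕ) : Set (Fin d → ℝ) := Set.Icc (fun _ => -1) (fun _ => 1)

/-- `g` is 2-periodic in every coordinate. Functions on `[-1,1]^d` with periodic boundary
conditions are identified with their 2-periodic extensions to `ℝ^d`. -/
def IsPeriodic {d : ℕ} (g : (Fin d → ℝ) → ℝ) : Prop :=
  ∀ (i : Fin d) (x : Fin d → ℝ), g (x + Pi.single i 2) = g x

/-- The circular convolution `(g * f)(x) = ∫_Ω g(y) f(x - y) dy` of two periodic functions. -/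
def circConv {d : ℕ} (g f : (Fin d → ℝ) → ℝ) (x : Fin d → ℝ) : ℝ :=
  ∫ y in cube d, g y * f (x - y)

/-- The `L¹(Ω)` norm. -/
def l1Norm {d : ℕ} (g : (Fin d → ℝ) → ℝ) : ℝ := ∫ y in cube d, |g y|

/-- The uniform norm `sup_{x ∈ Ω} |g x|`, with value `∞` if `g` is unbounded on `Ω`. -/
def supNorm {d : ℕ} (g : (Fin d → ℝ) → ℝ) : ℝ≥0∞ := ⨆ x ∈ cube d, ‖g x‖ₑ

/-! ### Trigonometric polynomials -/

/-- `soc(n, z)` is `1`, `sin (n π z)`, `cos (n π z)` for `n = 0`, `n > 0`, `n < 0`. -/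
def soc₁ (n : ℤ) (z : ℝ) : ℝ :=
  if n = 0 then 1
  else if 0 < n then Real.sin (n * Real.pi * z)
  else Real.cos (n * Real.pi * z)

/-- The multivariate monomial `soc(n, z) = ∏ i, soc(n i, z i)`. -/
def soc {d : ℕ} (n : Fin d → ℤ) (z : Fin d → ℝ) : ℝ := ∏ i, soc₁ (n i) (z i)

/-- The finite set of frequencies `n ∈ ℤ^d` with `‖n‖₁ ≤ N`. -/
def freq (d N : ℕ) : Finset (Fin d → ℤ) :=
  {n ∈ Fintype.piFinset fun _ : Fin d => Finset.Icc (-(N : ℤ)) N | ∑ i, |n i| ≤ (N : ℤ)}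

/-- The box in the definition of `freq` loses no frequency. -/
theorem mem_freq {d N : ℕ} (n : Fin d → ℤ) : n ∈ freq d N ↔ ∑ i, |n i| ≤ (N : ℤ) := by
  simp only [freq, Finset.mem_filter, Fintype.mem_piFinset, Finset.mem_Icc, ← abs_le,
    and_iff_right_iff_imp]
  intro h i
  exact (Finset.single_le_sum (f := fun i => |n i|) (fun j _ => abs_nonneg (n j))
    (Finset.mem_univ i)).trans h

/-- `𝕋_N`: the real trigonometric polynomials in `d` variables of degree at most `N`. -/
def trigPoly (d N : ℕ) : Set ((Fin d → ℝ) → ℝ) :=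
  {t | ∃ θ : (Fin d → ℤ) → ℝ, ∀ z, t z = ∑ n ∈ freq d N, θ n * soc n z}

/-- The best uniform approximation error `inf_{t ∈ 𝕋_N} ‖t - f‖_∞`. -/
def bestApprox {d : ℕ} (N : ℕ) (f : (Fin d → ℝ) → ℝ) : ℝ≥0∞ :=
  ⨅ t ∈ trigPoly d N, supNorm (fun x => t x - f x)

/-! ### Kernels -/

/-- The Dirichlet kernel of order `n`, `2^{-d} ∑_{‖k‖₁ ≤ n} e^{iπ k·z}` (which is real, by
symmetry under `k ↦ -k`). The factor `2^{-d}`, the inverse of the volume of `Ω`, makes convolution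
with it the truncation of the Fourier series to frequencies `‖k‖₁ ≤ n`. -/
def dirichletKernel (d n : ℕ) (z : Fin d → ℝ) : ℝ :=
  ((2 : ℝ) ^ d)⁻¹ * ∑ k ∈ freq d n, Real.cos (Real.pi * ∑ i, (k i : ℝ) * z i)

/-- The de la Vallée-Poussin kernel `D_N = (N/2 + 1)⁻¹ ∑_{n = N/2}^{N} D_n⁰`, for even `N`. -/
def vpKernel (d N : ℕ) (z : Fin d → ℝ) : ℝ :=
  (((N / 2 : ℕ) : ℝ) + 1)⁻¹ * ∑ n ∈ Finset.Icc (N / 2) N, dirichletKernel d n z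

/-! ### The spaces `C_p^{ν,1}` -/

/-- The partial derivative in the `i`-th coordinate. -/
def partialDeriv {d : ℕ} (i : Fin d) (g : (Fin d → ℝ) → ℝ) (x : Fin d → ℝ) : ℝ :=
  lineDeriv ℝ g x (Pi.single i 1)

/-- `D^α f = ∂₁^{α₁} (∂₂^{α₂} (⋯ ∂_d^{α_d} f))`. -/
def multiDeriv {d : ℕ} (α : Fin d → ℕ) (f : (Fin d → ℝ) → ℝ) : (Fin d → ℝ) → ℝ :=
  (List.finRange d).foldr (fun i g => (partialDeriv i)^[α i] g) f

/-- `‖f‖_{C^{ν,1}} = max_{|α| ≤ ν+1} ‖D^α f‖_{L^∞(Ω)}`. For `|α| = ν + 1` the derivative of a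
function in the space exists only almost everywhere, hence the essential supremum. -/
def cNorm {d : ℕ} (ν : ℕ) (f : (Fin d → ℝ) → ℝ) : ℝ≥0∞ :=
  ⨆ (α : Fin d → ℕ) (_ : ∑ i, α i ≤ ν + 1),
    MeasureTheory.eLpNorm (multiDeriv α f) ∞ (MeasureTheory.volume.restrict (cube d))

/-- `f ∈ C_p^{ν,1}([-1,1]^d)`: the periodic function `f` is `ν` times continuously differentiable,
its derivatives of order `ν` are Lipschitz (so `C_p^{0,1}` consists of the periodic Lipschitz
functions, and the derivatives of order `ν + 1` exist almost everywhere and agree with the weak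
ones), and its norm is finite. -/
structure MemCp {d : ℕ} (ν : ℕ) (f : (Fin d → ℝ) → ℝ) : Prop where
  periodic : IsPeriodic f
  contDiff : ContDiff ℝ ν f
  lipschitz : ∀ α : Fin d → ℕ, ∑ i, α i = ν → ∃ C : ℝ≥0, LipschitzWith C (multiDeriv α f)
  finite_norm : cNorm ν f < ∞

end TrigApprox

end

/-! Near-best approximation is Lebesgue's inequality. Convolution with `D_N` fixes `𝕋_{N/2}`, since
every averaged Dirichlet kernel does (`circConv_vpKernel`). Hence the error against any `t` in
`𝕋_{N/2}` is at most `(1 + Λ)‖t - f‖`, and reproduction of the constant `1` forces `Λ ≥ 1`, so `1 +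
Λ ≤ 2Λ` (`supNorm_sub_circConv_le`).

The hard point is the uniform `L¹` bound, because the `ℓ¹` ball of frequencies is not a product. Its
constraint involves only the number `∑ |k_i|`. Attaching `e^{iπφ|k_i|}` to each coordinate and
integrating against a one-dimensional Dirichlet sum in `φ` cuts off at `∑ |k_i| ≤ n`, so the kernel
is a superposition over `φ` of products of one-dimensional kernels (`dirichletKernel_eq_integral`).
A trapezoidal cutoff, equal to `1` wherever it matters, makes these factors finite sums with good
decay. Averaging over `n` acts on the `φ`-factor alone and yields a difference of Fejér sums, of
size `N⁻¹ (|φ| + N⁻¹)⁻²` (`norm_vpSum_le`). Cancellation between the two halves of each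
one-dimensional kernel bounds its `L¹` norm by `C ε⁻¹ (1 + N|φ|)^ε` (`integral_norm_modKernel_le`).
With `ε = 1/(2d)` the product of `d` factors grows only like `(1 + N|φ|)^{1/2}`, which the Fejér
decay absorbs (`integral_norm_vpSum_mul_prod_le`).

The rate is Jackson's theorem. If `K` is a tensor Jackson kernel, `g - K * g` is small when the
first differences of `g` are. This operator commutes with differences, so its `r`-th iterate on `f`
gains `r` such factors when the mixed differences of order `r` are bounded by the product of the
steps, while `f` changes only by a trigonometric polynomial (`bestApprox_le_of_mixedBound`). For `f`
in `C_p^{ν,1}` such a bound with `r = ν + 1` comes from the mean value theorem for `ν` of the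
differences and from absolute continuity along lines for the last (`MemCp.mixedBound`). -/

noncomputable section

namespace TrigApprox

open MeasureTheory
open scoped Pointwise

variable {d : ℕ}

/-! ### Characters -/

/-- The character `t ↦ e^{iπkt}` of the circle of length 2. -/
def expPi (k : ℤ) (t : ℝ) : ℂ := Complex.exp (((k * Real.pi * t : ℝ) : ℂ) * Complex.I)

/-- The character `x ↦ e^{iπ k·x}` of the torus. -/
def chr {d : ℕ} (k : Fin d → ℤ) (x : Fin d → ℝ) : ℂ := ∏ i, expPi (k i) (x i)

theorem expPi_eq (k : ℤ) (t : ℝ) :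
    expPi k t = Real.cos (k * Real.pi * t) + Real.sin (k * Real.pi * t) * Complex.I := by
  rw [expPi, Complex.exp_mul_I, Complex.ofReal_cos, Complex.ofReal_sin]

theorem expPi_neg_left (k : ℤ) (t : ℝ) : expPi (-k) t = expPi k (-t) := by
  simp [expPi]

theorem expPi_add_left (k l : ℤ) (t : ℝ) : expPi (k + l) t = expPi k t * expPi l t := by
  simp only [expPi, ← Complex.exp_add]; congr 1; push_cast; ring

theorem expPi_add_right (k : ℤ) (s t : ℝ) : expPi k (s + t) = expPi k s * expPi k t := by
  simp only [expPi, ← Complex.exp_add]; congr 1; push_cast; ring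

@[simp] theorem expPi_zero_left (t : ℝ) : expPi 0 t = 1 := by simp [expPi]

@[simp] theorem expPi_zero_right (k : ℤ) : expPi k 0 = 1 := by simp [expPi]

@[simp] theorem norm_expPi (k : ℤ) (t : ℝ) : ‖expPi k t‖ = 1 := by
  rw [expPi, Complex.norm_exp_ofReal_mul_I]

@[fun_prop] theorem continuous_expPi (k : ℤ) : Continuous (expPi k) := by
  unfold expPi; fun_prop

theorem expPi_two (k : ℤ) : expPi k 2 = 1 := by
  rw [expPi, Complex.exp_eq_one_iff]; exact ⟨k, by push_cast; ring⟩

theorem integral_expPi (k : ℤ) : ∫ t in (-1 : ℝ)..1, expPi k t = if k = 0 then 2 else 0 := by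
  split_ifs with h
  · subst h; simp; norm_num
  · have hc : ((k : ℂ) * Real.pi * Complex.I) ≠ 0 := by
      simp [h, Real.pi_ne_zero, Complex.I_ne_zero]
    have : ∀ t : ℝ, expPi k t = Complex.exp ((k : ℂ) * Real.pi * Complex.I * t) := by
      intro t; rw [expPi]; congr 1; push_cast; ring
    simp_rw [this]
    rw [integral_exp_mul_complex hc]
    have h2 := expPi_two k
    rw [show (2 : ℝ) = 1 + 1 by norm_num, expPi_add_right] at h2
    have e : expPi k 1 = expPi k (-1) := by
      have h3 : expPi k 1 * expPi k (-1) = 1 := by rw [← expPi_add_right]; simp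
      have h4 : expPi k 1 ≠ 0 := by intro h; simp [h] at h2
      exact mul_left_cancel₀ h4 (h2.trans h3.symm)
    rw [this, this] at e
    rw [e, sub_self, zero_div]


theorem chr_add_right (k : Fin d → ℤ) (x y : Fin d → ℝ) : chr k (x + y) = chr k x * chr k y := by
  simp [chr, expPi_add_right, Finset.prod_mul_distrib]

theorem chr_add_left (k l : Fin d → ℤ) (x : Fin d → ℝ) : chr (k + l) x = chr k x * chr l x := by
  simp [chr, expPi_add_left, Finset.prod_mul_distrib]

theorem chr_neg_left (k : Fin d → ℤ) (x : Fin d → ℝ) : chr (-k) x = chr k (-x) := by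
  simp [chr, expPi_neg_left]

theorem chr_sub_right (k : Fin d → ℤ) (x y : Fin d → ℝ) :
    chr k (x - y) = chr k x * chr (-k) y := by
  rw [sub_eq_add_neg, chr_add_right, chr_neg_left]

@[fun_prop] theorem continuous_chr (k : Fin d → ℤ) : Continuous (chr k) := by
  unfold chr; fun_prop

theorem chr_eq_exp (k : Fin d → ℤ) (x : Fin d → ℝ) :
    chr k x = Complex.exp (((Real.pi * ∑ i, (k i : ℝ) * x i : ℝ) : ℂ) * Complex.I) := by
  simp only [chr, expPi, ← Complex.exp_sum]
  congr 1
  rw [← Finset.sum_mul]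
  congr 1
  push_cast
  rw [Finset.mul_sum]
  exact Finset.sum_congr rfl fun i _ => by ring

/-! ### Integrals over the cube -/

theorem restrict_cube : (volume : Measure (Fin d → ℝ)).restrict (cube d) =
    Measure.pi fun _ => volume.restrict (Set.Icc (-1 : ℝ) 1) := by
  rw [cube, ← Set.pi_univ_Icc, volume_pi, Measure.restrict_pi_pi]

theorem integral_cube_prod {𝕜 : Type*} [RCLike 𝕜] (f : Fin d → ℝ → 𝕜) :
    ∫ x in cube d, ∏ i, f i (x i) = ∏ i, ∫ t in (-1 : ℝ)..1, f i t := by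
  rw [restrict_cube, integral_fintype_prod_eq_prod]
  refine Finset.prod_congr rfl fun i _ => ?_
  rw [intervalIntegral.integral_of_le (by norm_num), integral_Icc_eq_integral_Ioc]

theorem integral_chr (k : Fin d → ℤ) : ∫ x in cube d, chr k x = if k = 0 then 2 ^ d else 0 := by
  unfold chr
  rw [integral_cube_prod fun i => expPi (k i)]
  simp only [integral_expPi]
  split_ifs with h
  · subst h; simp
  · obtain ⟨i, hi⟩ := Function.ne_iff.1 h
    exact Finset.prod_eq_zero (Finset.mem_univ i) (if_neg hi)

theorem isCompact_cube : IsCompact (cube d) := isCompact_Icc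

theorem measurableSet_cube : MeasurableSet (cube d) := measurableSet_Icc

theorem integrableOn_cube {E : Type*} [NormedAddCommGroup E] {f : (Fin d → ℝ) → E}
    (hf : Continuous f) : IntegrableOn f (cube d) :=
  hf.continuousOn.integrableOn_compact isCompact_cube

/-- Periodicity with values in any type. -/
def Periodic2 {E : Type*} (g : (Fin d → ℝ) → E) : Prop :=
  ∀ (i : Fin d) (x : Fin d → ℝ), g (x + Pi.single i 2) = g x

/-- The basis `2 e₁, …, 2 e_d` spanning the period lattice. -/
def periodBasis (d : ℕ) : Module.Basis (Fin d) ℝ (Fin d → ℝ) :=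
  Module.Basis.isUnitSMul (v := Pi.basisFun ℝ (Fin d)) (w := fun _ => (2 : ℝ)) fun _ => by simp

theorem periodBasis_apply (i : Fin d) : periodBasis d i = Pi.single i 2 := by
  rw [periodBasis, Module.Basis.isUnitSMul_apply]
  ext j
  by_cases h : j = i <;> simp [h]

/-- The lattice of periods. -/
def periodLattice (d : ℕ) : AddSubgroup (Fin d → ℝ) :=
  (Submodule.span ℤ (Set.range (periodBasis d))).toAddSubgroup

instance : Countable (periodLattice d) :=
  inferInstanceAs (Countable (Submodule.span ℤ (Set.range (periodBasis d))))

theorem Periodic2.add_period {E : Type*} {g : (Fin d → ℝ) → E} (hg : Periodic2 g)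
    (p : periodLattice d) (x : Fin d → ℝ) : g (p +ᵥ x) = g x := by
  have key : ∀ q ∈ Submodule.span ℤ (Set.range (periodBasis d)), ∀ x, g (q + x) = g x := by
    intro q hq
    induction hq using Submodule.span_induction with
    | mem y hy =>
      obtain ⟨i, rfl⟩ := hy
      intro x
      rw [periodBasis_apply, add_comm, hg]
    | zero => simp
    | add y z hy hz h1 h2 => intro x; rw [add_assoc, h1, h2]
    | smul a y hy h =>
      have hn : ∀ x, g (-y + x) = g x := fun x => by
        rw [← h (-y + x), add_neg_cancel_left]
      induction a using Int.induction_on with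
      | zero => simp
      | succ n ih => intro x; rw [add_smul, one_smul, add_assoc, ih, h]
      | pred n ih => intro x; rw [sub_smul, one_smul, sub_eq_add_neg, add_assoc, ih, hn]
  exact key p p.2 x

theorem isAddFundamentalDomain_translate (a : Fin d → ℝ) :
    IsAddFundamentalDomain (periodLattice d)
      (a +ᵥ ZSpan.fundamentalDomain (periodBasis d)) volume :=
  (ZSpan.isAddFundamentalDomain' (periodBasis d) volume).vadd_of_comm a

theorem translate_fundamentalDomain_ae_eq_cube :
    ((fun _ => -1 : Fin d → ℝ) +ᵥ ZSpan.fundamentalDomain (periodBasis d) : Set (Fin d → ℝ))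
      =ᵐ[volume] cube d := by
  have : ((fun _ => -1 : Fin d → ℝ) +ᵥ ZSpan.fundamentalDomain (periodBasis d) :
      Set (Fin d → ℝ)) = Set.univ.pi fun _ => Set.Ico (-1 : ℝ) 1 := by
    ext x
    rw [Set.mem_vadd_set_iff_neg_vadd_mem]
    simp only [ZSpan.mem_fundamentalDomain, periodBasis, Module.Basis.repr_isUnitSMul,
      Set.mem_pi, Set.mem_univ, true_imp_iff]
    refine forall_congr' fun i => ?_
    have h2 : ((show IsUnit (2 : ℝ) by simp).unit⁻¹ : ℝˣ) • (1 + x i) = (1 + x i) / 2 := by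
      rw [Units.smul_def, Units.val_inv_eq_inv_val]; simp; ring
    simp only [vadd_eq_add, Pi.basisFun_repr, Pi.add_apply, Pi.neg_apply, neg_neg, h2, Set.mem_Ico]
    constructor <;> rintro ⟨h3, h4⟩ <;> constructor <;> linarith
  rw [this]
  exact Measure.univ_pi_Ico_ae_eq_Icc

/-- Up to a null set the cube is a fundamental domain of the period lattice, and so is each of its
translates; a periodic integrand has the same integral over all of them. -/
theorem integral_cube_comp_sub {E : Type*} [NormedAddCommGroup E] [NormedSpace ℝ E]
    {g : (Fin d → ℝ) → E} (hg : Periodic2 g) (x : Fin d → ℝ) :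
    ∫ y in cube d, g (x - y) = ∫ y in cube d, g (-y) := by
  set h : (Fin d → ℝ) → E := fun y => g (-y) with hh
  have hper : Periodic2 h := fun i y => by
    rw [hh]; dsimp only
    rw [← hg i (-(y + Pi.single i 2))]; congr 1; abel
  set D := ZSpan.fundamentalDomain (periodBasis d)
  set a : Fin d → ℝ := fun _ => -1
  have hD : ∫ y in cube d, h y = ∫ y in (a +ᵥ D : Set _), h y :=
    (setIntegral_congr_set translate_fundamentalDomain_ae_eq_cube).symm
  have h1 : ∫ y in cube d, g (x - y) = ∫ y in (a +ᵥ D : Set _), h (-x + y) := by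
    rw [setIntegral_congr_set translate_fundamentalDomain_ae_eq_cube]
    refine integral_congr_ae (.of_forall fun y => ?_)
    rw [hh]; dsimp only; congr 1; abel
  rw [h1]
  change _ = ∫ y in cube d, h y
  rw [hD]
  have h2 : ∫ y in (a +ᵥ D : Set _), h (-x + y) = ∫ y in (-x +ᵥ (a +ᵥ D) : Set _), h y :=
    ((measurePreserving_vadd (-x) volume).setIntegral_image_emb
      (measurableEmbedding_const_vadd _) h (a +ᵥ D)).symm
  rw [h2, vadd_vadd]
  exact (isAddFundamentalDomain_translate _).setIntegral_eq (isAddFundamentalDomain_translate _)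
    hper.add_period

/-! ### Complex trigonometric polynomials -/

/-- The complex span of the characters of degree at most `N`. -/
def trigSpan (d N : ℕ) : Submodule ℂ ((Fin d → ℝ) → ℂ) :=
  Submodule.span ℂ (chr '' (freq d N : Set (Fin d → ℤ)))

theorem chr_mem_trigSpan {N : ℕ} {k : Fin d → ℤ} (hk : k ∈ freq d N) : chr k ∈ trigSpan d N :=
  Submodule.subset_span ⟨k, hk, rfl⟩

theorem mem_freq_of_abs_eq {N : ℕ} {k l : Fin d → ℤ} (hk : k ∈ freq d N)
    (h : ∀ i, |l i| = |k i|) : l ∈ freq d N := by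
  rw [mem_freq] at hk ⊢
  simpa only [h] using hk

theorem neg_mem_freq {N : ℕ} {k : Fin d → ℤ} (hk : k ∈ freq d N) : -k ∈ freq d N :=
  mem_freq_of_abs_eq hk fun i => by simp

/-- The real span of the monomials `soc n` is the set of trigonometric polynomials. -/
theorem mem_trigPoly_iff_mem_span {N : ℕ} {t : (Fin d → ℝ) → ℝ} :
    t ∈ trigPoly d N ↔ t ∈ Submodule.span ℝ (soc '' (freq d N : Set (Fin d → ℤ))) := by
  constructor
  · rintro ⟨θ, h⟩
    have : t = ∑ n ∈ freq d N, θ n • soc n := by ext z; simp [h z, Finset.sum_apply]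
    rw [this]
    exact Submodule.sum_mem _ fun n hn =>
      Submodule.smul_mem _ _ (Submodule.subset_span ⟨n, hn, rfl⟩)
  · intro h
    induction h using Submodule.span_induction with
    | mem t h =>
      obtain ⟨n, hn, rfl⟩ := h
      exact ⟨Pi.single n 1, fun z => by simp [Pi.single_apply, Finset.mem_coe.1 hn]⟩
    | zero => exact ⟨0, fun z => by simp⟩
    | add x y _ _ hx hy =>
      obtain ⟨θ, h⟩ := hx
      obtain ⟨η, h'⟩ := hy
      exact ⟨θ + η, fun z => by simp [h z, h' z, add_mul, Finset.sum_add_distrib]⟩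
    | smul a x _ hx =>
      obtain ⟨θ, h⟩ := hx
      exact ⟨a • θ, fun z => by simp [h z, Finset.mul_sum, mul_assoc]⟩

/-- Euler's formulas mix only the frequencies `n` and `-n`. In both directions the change of basis
therefore preserves `|n i|` in every coordinate, hence the degree. -/
theorem soc₁_eq_expPi (n : ℤ) : ∃ a b : ℂ, ∀ t : ℝ,
    (soc₁ n t : ℂ) = a * expPi n t + b * expPi (-n) t := by
  rcases lt_trichotomy n 0 with h | h | h
  · refine ⟨1 / 2, 1 / 2, fun t => ?_⟩
    rw [soc₁, if_neg h.ne, if_neg h.not_gt, expPi_eq, expPi_eq]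
    push_cast
    rw [neg_mul, neg_mul, Complex.cos_neg, Complex.sin_neg]; ring
  · exact ⟨1, 0, fun t => by simp [soc₁, h]⟩
  · refine ⟨-Complex.I / 2, Complex.I / 2, fun t => ?_⟩
    rw [soc₁, if_neg h.ne', if_pos h, expPi_eq, expPi_eq]
    push_cast
    rw [neg_mul, neg_mul, Complex.cos_neg, Complex.sin_neg]
    ring_nf
    rw [Complex.I_sq]; ring

theorem expPi_eq_soc₁ (n : ℤ) : ∃ a b : ℂ, ∀ t : ℝ,
    expPi n t = a * soc₁ n t + b * soc₁ (-n) t := by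
  rcases lt_trichotomy n 0 with h | h | h
  · refine ⟨1, -Complex.I, fun t => ?_⟩
    rw [soc₁, soc₁, if_neg h.ne, if_neg h.not_gt, if_neg (by omega), if_pos (by omega), expPi_eq]
    push_cast
    rw [neg_mul (n : ℂ), neg_mul ((n : ℂ) * _), Complex.sin_neg]
    linear_combination (-Complex.sin (n * Real.pi * t)) * Complex.I_sq +
      (Complex.sin (n * Real.pi * t)) * Complex.I_sq
  · exact ⟨1, 0, fun t => by simp [soc₁, h]⟩
  · refine ⟨Complex.I, 1, fun t => ?_⟩
    rw [soc₁, soc₁, if_neg h.ne', if_pos h, if_neg (by omega), if_neg (by omega), expPi_eq]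
    push_cast
    rw [neg_mul, neg_mul, Complex.cos_neg]; ring

/-- Expanding a product of binary sums whose terms are indexed by `n i` and `-n i`. -/
theorem exists_expand_prod {u v : ℤ → ℝ → ℂ} (n : Fin d → ℤ)
    (h : ∀ m, ∃ a b : ℂ, ∀ t, u m t = a * v m t + b * v (-m) t) :
    ∃ c : Finset (Fin d) → ℂ, ∀ z : Fin d → ℝ, ∏ i, u (n i) (z i) =
      ∑ S : Finset (Fin d), c S * ∏ i, v (if i ∈ S then n i else -n i) (z i) := by
  choose a b hab using h
  refine ⟨fun S => ∏ i, if i ∈ S then a (n i) else b (n i), fun z => ?_⟩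
  simp only [hab, Finset.prod_add, Finset.powerset_univ]
  refine Finset.sum_congr rfl fun S _ => ?_
  rw [← Finset.prod_mul_distrib, ← Finset.prod_mul_prod_compl S, Finset.compl_eq_univ_sdiff]
  congr 1 <;> refine Finset.prod_congr rfl fun i hi => ?_
  · simp [hi]
  · simp [(Finset.mem_sdiff.1 hi).2]

theorem abs_ite_neg (S : Finset (Fin d)) (n : Fin d → ℤ) (i : Fin d) :
    |(if i ∈ S then n i else -n i)| = |n i| := by
  split_ifs <;> simp

theorem ofReal_mem_trigSpan {N : ℕ} {t : (Fin d → ℝ) → ℝ} (ht : t ∈ trigPoly d N) :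
    (fun z => (t z : ℂ)) ∈ trigSpan d N := by
  rw [mem_trigPoly_iff_mem_span] at ht
  induction ht using Submodule.span_induction with
  | mem t h =>
    obtain ⟨n, hn, rfl⟩ := h
    obtain ⟨c, hc⟩ := exists_expand_prod (v := expPi) n soc₁_eq_expPi
    have : (fun z => (soc n z : ℂ)) =
        ∑ S : Finset (Fin d), c S • chr fun i => if i ∈ S then n i else -n i := by
      ext z
      simp [soc, hc, Finset.sum_apply, chr]
    rw [this]
    exact Submodule.sum_mem _ fun S _ => Submodule.smul_mem _ _
      (chr_mem_trigSpan (mem_freq_of_abs_eq hn (abs_ite_neg S n)))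
  | zero => exact Submodule.zero_mem (trigSpan d N)
  | add x y _ _ hx hy => simpa [Pi.add_def] using Submodule.add_mem _ hx hy
  | smul a x _ hx => simpa [Pi.smul_def] using Submodule.smul_mem _ (a : ℂ) hx

theorem re_mem_trigPoly {N : ℕ} {u : (Fin d → ℝ) → ℂ} (hu : u ∈ trigSpan d N) :
    (fun z => (u z).re) ∈ trigPoly d N := by
  -- The real part is not complex linear; allowing a complex factor `a` makes the claim stable under
  -- scalars in the induction over the span.
  suffices h : ∀ a : ℂ, (fun z => (a * u z).re) ∈
      Submodule.span ℝ (soc '' (freq d N : Set (Fin d → ℤ))) by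
    rw [mem_trigPoly_iff_mem_span]; simpa using h 1
  induction hu using Submodule.span_induction with
  | mem u h =>
    obtain ⟨n, hn, rfl⟩ := h
    obtain ⟨c, hc⟩ := exists_expand_prod (v := fun n t => (soc₁ n t : ℂ)) n expPi_eq_soc₁
    intro a
    have : (fun z => (a * chr n z).re) =
        ∑ S : Finset (Fin d), (a * c S).re • soc fun i => if i ∈ S then n i else -n i := by
      ext z
      rw [chr, hc, Finset.mul_sum, Complex.re_sum, Finset.sum_apply]
      refine Finset.sum_congr rfl fun S _ => ?_
      rw [← Complex.ofReal_prod, ← mul_assoc, Complex.re_mul_ofReal, Pi.smul_apply, soc,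
        smul_eq_mul]
    rw [this]
    exact Submodule.sum_mem _ fun S _ => Submodule.smul_mem _ _
      (Submodule.subset_span ⟨_, mem_freq_of_abs_eq hn (abs_ite_neg S n), rfl⟩)
  | zero =>
    intro a
    simp only [Pi.zero_apply, mul_zero, Complex.zero_re]
    exact Submodule.zero_mem (Submodule.span ℝ (soc '' (freq d N : Set (Fin d → ℤ))))
  | add x y _ _ hx hy =>
    intro a
    simpa only [Pi.add_def, mul_add, Complex.add_re] using Submodule.add_mem _ (hx a) (hy a)
  | smul b x _ hx => intro a; simpa [mul_assoc] using hx (a * b)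

theorem mem_trigPoly_iff {N : ℕ} {t : (Fin d → ℝ) → ℝ} :
    t ∈ trigPoly d N ↔ (fun z => (t z : ℂ)) ∈ trigSpan d N :=
  ⟨ofReal_mem_trigSpan, fun h => by simpa using re_mem_trigPoly h⟩

theorem trigSpan_mono {M N : ℕ} (h : M ≤ N) : trigSpan d M ≤ trigSpan d N := by
  refine Submodule.span_mono (Set.image_mono fun k hk => ?_)
  rw [Finset.mem_coe, mem_freq] at hk ⊢
  exact hk.trans (by exact_mod_cast h)

theorem add_mem_trigPoly {N : ℕ} {s t : (Fin d → ℝ) → ℝ} (hs : s ∈ trigPoly d N)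
    (ht : t ∈ trigPoly d N) : (fun x => s x + t x) ∈ trigPoly d N := by
  rw [mem_trigPoly_iff_mem_span] at *
  exact Submodule.add_mem _ hs ht

theorem zero_mem_trigPoly (N : ℕ) : (fun _ => 0) ∈ trigPoly d N := by
  rw [mem_trigPoly_iff_mem_span]
  exact Submodule.zero_mem _

theorem trigPoly_mono {M N : ℕ} (h : M ≤ N) : trigPoly d M ⊆ trigPoly d N := fun _ ht =>
  mem_trigPoly_iff.2 (trigSpan_mono h (mem_trigPoly_iff.1 ht))

theorem continuous_of_mem_trigSpan {N : ℕ} {u : (Fin d → ℝ) → ℂ} (hu : u ∈ trigSpan d N) :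
    Continuous u := by
  induction hu using Submodule.span_induction with
  | mem u h => obtain ⟨n, hn, rfl⟩ := h; fun_prop
  | zero => exact continuous_const
  | add x y _ _ hx hy => exact hx.add hy
  | smul b x _ hx => exact hx.const_smul b

theorem continuous_of_mem_trigPoly {N : ℕ} {t : (Fin d → ℝ) → ℝ} (ht : t ∈ trigPoly d N) :
    Continuous t := by
  have := Complex.continuous_re.comp (continuous_of_mem_trigSpan (mem_trigPoly_iff.1 ht))
  simpa [Function.comp_def] using this

theorem chr_periodic (k : Fin d → ℤ) : Periodic2 (chr k) := fun i x => by
  rw [chr_add_right]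
  suffices h : chr k (Pi.single i 2) = 1 by rw [h, mul_one]
  refine Finset.prod_eq_one fun j _ => ?_
  by_cases h : j = i
  · subst h; simp [expPi_two]
  · simp [h]

theorem periodic_of_mem_trigSpan {N : ℕ} {u : (Fin d → ℝ) → ℂ} (hu : u ∈ trigSpan d N) :
    Periodic2 u := by
  induction hu using Submodule.span_induction with
  | mem u h => obtain ⟨n, hn, rfl⟩ := h; exact chr_periodic n
  | zero => exact fun i x => rfl
  | add x y _ _ hx hy => exact fun i z => by simp [hx i z, hy i z]
  | smul b x _ hx => exact fun i z => by simp [hx i z]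

theorem periodic_of_mem_trigPoly {N : ℕ} {t : (Fin d → ℝ) → ℝ} (ht : t ∈ trigPoly d N) :
    IsPeriodic t := fun i x => by
  have := periodic_of_mem_trigSpan (mem_trigPoly_iff.1 ht) i x
  exact_mod_cast this

theorem ofReal_circConv (K f : (Fin d → ℝ) → ℝ) (x : Fin d → ℝ) :
    (circConv K f x : ℂ) = ∫ y in cube d, (K y : ℂ) * f (x - y) := by
  rw [circConv, ← integral_complex_ofReal]
  push_cast
  rfl

/-- Convolution with a trigonometric polynomial gives a trigonometric polynomial. -/
theorem circConv_mem_trigPoly {N : ℕ} {K f : (Fin d → ℝ) → ℝ} (hK : K ∈ trigPoly d N)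
    (hf : IsPeriodic f) (hc : Continuous f) : circConv K f ∈ trigPoly d N := by
  rw [mem_trigPoly_iff]
  simp only [ofReal_circConv]
  suffices h : ∀ u ∈ trigSpan d N, (fun x => ∫ y in cube d, u y * (f (x - y) : ℂ)) ∈
    trigSpan d N from h _ (mem_trigPoly_iff.1 hK)
  intro u hu
  induction hu using Submodule.span_induction with
  | mem u h =>
    obtain ⟨k, hk, rfl⟩ := h
    have : (fun x => ∫ y in cube d, chr k y * f (x - y)) =
        (∫ y in cube d, chr k y * f (-y)) • chr k := by
      ext x
      -- Once `chr k x` is pulled out, the integrand is a periodic function of `x - y`, so its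
      -- integral is a constant: a Fourier coefficient of `f`.
      have h1 : ∀ y, chr k y * f (x - y) = chr k x * (chr (-k) (x - y) * f (x - y)) := fun y => by
        rw [chr_sub_right, neg_neg, ← mul_assoc, ← mul_assoc, ← chr_add_left]
        simp [chr]
      simp_rw [h1]
      rw [integral_const_mul, integral_cube_comp_sub (g := fun y => chr (-k) y * (f y : ℂ))
        (fun i y => by dsimp only; rw [chr_periodic, hf i y])]
      simp only [chr_neg_left, neg_neg, Pi.smul_apply, smul_eq_mul]
      rw [mul_comm]
    rw [this]
    exact Submodule.smul_mem _ _ (chr_mem_trigSpan hk)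
  | zero =>
    simp only [Pi.zero_apply, zero_mul, integral_zero]
    exact Submodule.zero_mem (trigSpan d N)
  | add v w hv hw h1 h2 =>
    have hv' := continuous_of_mem_trigSpan hv
    have hw' := continuous_of_mem_trigSpan hw
    have : (fun x => ∫ y in cube d, (v + w) y * f (x - y)) =
        (fun x => ∫ y in cube d, v y * f (x - y)) + fun x => ∫ y in cube d, w y * f (x - y) := by
      ext x
      simp only [Pi.add_apply, add_mul]
      exact integral_add (integrableOn_cube (by fun_prop)) (integrableOn_cube (by fun_prop))
    rw [this]
    exact Submodule.add_mem _ h1 h2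
  | smul b v hv h1 =>
    have : (fun x => ∫ y in cube d, (b • v) y * f (x - y)) =
        b • fun x => ∫ y in cube d, v y * f (x - y) := by
      ext x
      simp only [Pi.smul_apply, smul_eq_mul, mul_assoc, integral_const_mul]
    rw [this]
    exact Submodule.smul_mem _ _ h1

/-! ### Reproduction of trigonometric polynomials and near-best approximation -/

theorem ofReal_dirichletKernel (n : ℕ) (z : Fin d → ℝ) :
    (dirichletKernel d n z : ℂ) = ((2 : ℂ) ^ d)⁻¹ * ∑ k ∈ freq d n, chr k z := by
  have h1 : ∑ k ∈ freq d n, Real.sin (Real.pi * ∑ i, (k i : ℝ) * z i) = 0 := by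
    have h2 : ∑ k ∈ freq d n, Real.sin (Real.pi * ∑ i, (k i : ℝ) * z i) =
        ∑ k ∈ freq d n, -Real.sin (Real.pi * ∑ i, (k i : ℝ) * z i) := by
      refine Finset.sum_bij' (fun k _ => -k) (fun k _ => -k) (fun k => neg_mem_freq)
        (fun k => neg_mem_freq) (fun k _ => neg_neg k) (fun k _ => neg_neg k) fun k _ => ?_
      simp [Real.sin_neg]
    rw [Finset.sum_neg_distrib] at h2
    linarith
  rw [dirichletKernel]
  push_cast
  congr 1
  have h3 : ∀ k : Fin d → ℤ, chr k z = (Real.cos (Real.pi * ∑ i, (k i : ℝ) * z i) : ℝ) +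
      (Real.sin (Real.pi * ∑ i, (k i : ℝ) * z i) : ℝ) * Complex.I := fun k => by
    rw [chr_eq_exp, Complex.exp_mul_I, Complex.ofReal_cos, Complex.ofReal_sin]
  simp_rw [h3]
  rw [Finset.sum_add_distrib, ← Finset.sum_mul, ← Complex.ofReal_sum (freq d n)
    (fun k => Real.sin (Real.pi * ∑ i, (k i : ℝ) * z i)), h1]
  push_cast
  simp

theorem dirichletKernel_mem_trigPoly (n : ℕ) : dirichletKernel d n ∈ trigPoly d n := by
  rw [mem_trigPoly_iff]
  have : (fun z => (dirichletKernel d n z : ℂ)) = ((2 : ℂ) ^ d)⁻¹ • ∑ k ∈ freq d n, chr k := by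
    ext z; simp [ofReal_dirichletKernel, Finset.sum_apply]
  rw [this]
  exact Submodule.smul_mem _ _ (Submodule.sum_mem _ fun k hk => chr_mem_trigSpan hk)

theorem vpKernel_mem_trigPoly (N : ℕ) : vpKernel d N ∈ trigPoly d N := by
  rw [mem_trigPoly_iff_mem_span]
  have : vpKernel d N = (((N / 2 : ℕ) : ℝ) + 1)⁻¹ •
      ∑ n ∈ Finset.Icc (N / 2) N, dirichletKernel d n := by
    ext z; simp [vpKernel, Finset.sum_apply]
  rw [this]
  refine Submodule.smul_mem _ _ (Submodule.sum_mem _ fun n hn => ?_)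
  rw [← mem_trigPoly_iff_mem_span]
  exact trigPoly_mono (Finset.mem_Icc.1 hn).2 (dirichletKernel_mem_trigPoly n)

theorem continuous_dirichletKernel (n : ℕ) : Continuous (dirichletKernel d n) :=
  continuous_of_mem_trigPoly (dirichletKernel_mem_trigPoly n)

/-- Orthogonality of characters: exactly one frequency of the kernel matches a given character of
degree at most `n`, and its mass `2 ^ d` is cancelled by the normalization. -/
theorem integral_dirichletKernel_mul {n : ℕ} {u : (Fin d → ℝ) → ℂ} (hu : u ∈ trigSpan d n)
    (x : Fin d → ℝ) : ∫ y in cube d, (dirichletKernel d n y : ℂ) * u (x - y) = u x := by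
  have hD := continuous_dirichletKernel (d := d) n
  induction hu using Submodule.span_induction with
  | mem u h =>
    obtain ⟨l, hl, rfl⟩ := h
    have h1 : ∀ y, (dirichletKernel d n y : ℂ) * chr l (x - y) =
        chr l x * (((2 : ℂ) ^ d)⁻¹ * ∑ k ∈ freq d n, chr (k + -l) y) := fun y => by
      rw [ofReal_dirichletKernel, chr_sub_right]
      simp_rw [chr_add_left _ (-l)]
      rw [← Finset.sum_mul]; ring
    simp_rw [h1]
    rw [integral_const_mul, integral_const_mul,
      integral_finsetSum _ fun k _ => integrableOn_cube (continuous_chr _)]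
    simp_rw [integral_chr, ← sub_eq_add_neg, sub_eq_zero]
    rw [Finset.sum_ite_eq' (freq d n), if_pos (Finset.mem_coe.1 hl), inv_mul_cancel₀ (by simp),
      mul_one]
  | zero => simp
  | add v w hv hw h1 h2 =>
    have hv' := continuous_of_mem_trigSpan hv
    have hw' := continuous_of_mem_trigSpan hw
    simp only [Pi.add_apply, mul_add]
    rw [← h1, ← h2]
    exact integral_add (integrableOn_cube (by fun_prop)) (integrableOn_cube (by fun_prop))
  | smul b v hv h1 =>
    simp only [Pi.smul_apply, smul_eq_mul, mul_left_comm _ b, integral_const_mul, h1]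

theorem circConv_dirichletKernel {n : ℕ} {t : (Fin d → ℝ) → ℝ} (ht : t ∈ trigPoly d n)
    (x : Fin d → ℝ) : circConv (dirichletKernel d n) t x = t x := by
  have := integral_dirichletKernel_mul (mem_trigPoly_iff.1 ht) x
  rw [← ofReal_circConv] at this
  exact_mod_cast this

theorem circConv_vpKernel {N : ℕ} (hN : Even N) {t : (Fin d → ℝ) → ℝ}
    (ht : t ∈ trigPoly d (N / 2)) (x : Fin d → ℝ) : circConv (vpKernel d N) t x = t x := by
  have hc := continuous_of_mem_trigPoly ht
  have h1 : ∀ y, vpKernel d N y * t (x - y) = (((N / 2 : ℕ) : ℝ) + 1)⁻¹ *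
      ∑ n ∈ Finset.Icc (N / 2) N, dirichletKernel d n y * t (x - y) := fun y => by
    rw [vpKernel, mul_assoc, Finset.sum_mul]
  rw [circConv]
  simp_rw [h1]
  rw [integral_const_mul, integral_finsetSum _ fun n _ => integrableOn_cube
    (by have := continuous_dirichletKernel (d := d) n; fun_prop)]
  have h2 : ∀ n ∈ Finset.Icc (N / 2) N,
      ∫ y in cube d, dirichletKernel d n y * t (x - y) = t x := fun n hn =>
    circConv_dirichletKernel (trigPoly_mono (Finset.mem_Icc.1 hn).1 ht) x
  rw [Finset.sum_congr rfl h2, Finset.sum_const, Nat.card_Icc, nsmul_eq_mul, ← mul_assoc]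
  -- Evenness enters here: it makes the number of averaged kernels equal to the normalizing factor.
  have : N + 1 - N / 2 = N / 2 + 1 := by obtain ⟨m, rfl⟩ := hN; omega
  rw [this]
  push_cast
  rw [inv_mul_cancel₀ (by positivity), one_mul]

/-! ### Uniform norms and Lebesgue's inequality. -/

theorem Periodic2.exists_mem_cube {E : Type*} {g : (Fin d → ℝ) → E} (hg : Periodic2 g)
    (x : Fin d → ℝ) : ∃ y ∈ cube d, g y = g x := by
  obtain ⟨p, hp, -⟩ := ZSpan.exist_unique_vadd_mem_fundamentalDomain (periodBasis d)
    (x + fun _ => 1)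
  refine ⟨p +ᵥ x, ?_, hg.add_period p x⟩
  have h : ∀ i, ((p : Fin d → ℝ) + x) i ∈ Set.Ico (-1 : ℝ) 1 := fun i => by
    have h1 := (ZSpan.mem_fundamentalDomain _).1 hp i
    simp only [periodBasis, Module.Basis.repr_isUnitSMul] at h1
    rw [Units.smul_def, Units.val_inv_eq_inv_val] at h1
    simp only [IsUnit.unit_spec, Pi.basisFun_repr, smul_eq_mul, Set.mem_Ico] at h1
    change 0 ≤ 2⁻¹ * ((p : Fin d → ℝ) i + (x i + 1)) ∧
      2⁻¹ * ((p : Fin d → ℝ) i + (x i + 1)) < 1 at h1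
    rw [Pi.add_apply]
    constructor <;> linarith
  exact ⟨fun i => (h i).1, fun i => (h i).2.le⟩

theorem abs_le_of_supNorm_le {g : (Fin d → ℝ) → ℝ} (hg : IsPeriodic g) (h : supNorm g ≠ ∞)
    (x : Fin d → ℝ) : |g x| ≤ (supNorm g).toReal := by
  obtain ⟨y, hy, hxy⟩ := Periodic2.exists_mem_cube (g := g) hg x
  rw [← hxy, ← Real.norm_eq_abs, ← toReal_enorm]
  exact ENNReal.toReal_mono h (le_iSup₂ (f := fun x (_ : x ∈ cube d) => ‖g x‖ₑ) y hy)

theorem supNorm_le_ofReal {g : (Fin d → ℝ) → ℝ} {C : ℝ} (h : ∀ x, |g x| ≤ C) :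
    supNorm g ≤ ENNReal.ofReal C :=
  iSup₂_le fun x _ => by
    rw [Real.enorm_eq_ofReal_abs]
    exact ENNReal.ofReal_le_ofReal (h x)

theorem abs_circConv_le {K g : (Fin d → ℝ) → ℝ} (hK : Continuous K) {δ : ℝ}
    (hg : ∀ x, |g x| ≤ δ) (x : Fin d → ℝ) : |circConv K g x| ≤ l1Norm K * δ := by
  rw [circConv, l1Norm, ← integral_mul_const, ← Real.norm_eq_abs]
  refine norm_integral_le_of_norm_le (integrableOn_cube (by fun_prop)) (.of_forall fun y => ?_)
  rw [norm_mul, Real.norm_eq_abs, Real.norm_eq_abs]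
  exact mul_le_mul_of_nonneg_left (hg _) (abs_nonneg _)

theorem circConv_sub {K f g : (Fin d → ℝ) → ℝ} (hK : Continuous K) (hf : Continuous f)
    (hg : Continuous g) (x : Fin d → ℝ) :
    circConv K (fun x => f x - g x) x = circConv K f x - circConv K g x := by
  simp only [circConv, mul_sub]
  exact integral_sub (integrableOn_cube (by fun_prop)) (integrableOn_cube (by fun_prop))

theorem one_mem_trigPoly (N : ℕ) : (fun _ => 1) ∈ trigPoly d N := by
  rw [mem_trigPoly_iff]
  have : (fun _ => ((1 : ℝ) : ℂ)) = chr (0 : Fin d → ℤ) := by ext z; simp [chr]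
  rw [this]
  exact chr_mem_trigSpan (by rw [mem_freq]; simp)

theorem one_le_l1Norm {M : ℕ} {K : (Fin d → ℝ) → ℝ} (hK : Continuous K)
    (hrep : ∀ t ∈ trigPoly d M, ∀ x, circConv K t x = t x) : 1 ≤ l1Norm K := by
  have h := abs_circConv_le hK (g := fun _ => 1) (δ := 1) (fun x => by simp) 0
  rwa [hrep _ (one_mem_trigPoly M), abs_one, mul_one] at h

/-- A convolution operator reproducing `𝕋_M` is near-best. -/
theorem supNorm_sub_circConv_le {M : ℕ} {Λ : ℝ} {K f : (Fin d → ℝ) → ℝ} (hK : Continuous K)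
    (hrep : ∀ t ∈ trigPoly d M, ∀ x, circConv K t x = t x) (hΛ : l1Norm K ≤ Λ)
    (hf : IsPeriodic f) (hfc : Continuous f) :
    supNorm (fun x => f x - circConv K f x) ≤ ENNReal.ofReal (2 * Λ) * bestApprox M f := by
  have h1 : 1 ≤ Λ := (one_le_l1Norm hK hrep).trans hΛ
  have h0 : ENNReal.ofReal (2 * Λ) ≠ 0 := by
    rw [Ne, ENNReal.ofReal_eq_zero]; linarith
  rw [bestApprox]
  simp_rw [ENNReal.mul_iInf_of_ne h0 ENNReal.ofReal_ne_top]
  refine le_iInf₂ fun t ht => ?_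
  by_cases hs : supNorm (fun x => t x - f x) = ∞
  · rw [hs, ENNReal.mul_top h0]; exact le_top
  have htc := continuous_of_mem_trigPoly ht
  have htp := periodic_of_mem_trigPoly ht
  have hb := abs_le_of_supNorm_le (g := fun x => t x - f x)
    (fun i x => by dsimp only; rw [htp, hf]) hs
  have hδ : 0 ≤ (supNorm fun x => t x - f x).toReal := ENNReal.toReal_nonneg
  rw [← ENNReal.ofReal_toReal hs, ← ENNReal.ofReal_mul (by linarith)]
  refine supNorm_le_ofReal fun x => ?_
  have h2 := abs_circConv_le hK hb x
  rw [circConv_sub hK htc hfc, hrep t ht] at h2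
  -- Since `t = K * t`, the first bracket is `K * (t - f)`; the two brackets cost `Λ` and `1` times
  -- the error of `t`.
  have h3 : f x - circConv K f x = (t x - circConv K f x) - (t x - f x) := by ring
  rw [h3]
  refine (abs_sub _ _).trans ?_
  have := hb x
  nlinarith [mul_le_mul_of_nonneg_right hΛ hδ, mul_le_mul_of_nonneg_right h1 hδ]

/-! ### One-dimensional kernels -/

theorem expPi_natCast (j : ℕ) (t : ℝ) : expPi j t = expPi 1 t ^ j := by
  rw [expPi, expPi, ← Complex.exp_nat_mul]; congr 1; push_cast; ring

theorem conj_expPi (k : ℤ) (t : ℝ) : (starRingEnd ℂ) (expPi k t) = expPi (-k) t := by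
  rw [expPi, expPi, ← Complex.exp_conj]; congr 1
  rw [map_mul, Complex.conj_ofReal, Complex.conj_I]; push_cast; ring

/-- Both half-sums contain the index `0`, hence the extra `F 0`. -/
theorem sum_Icc_neg_add (n : ℕ) (F : ℤ → ℂ) : ∑ k ∈ Finset.Icc (-(n : ℤ)) n, F k + F 0 =
    ∑ j ∈ Finset.range (n + 1), F j + ∑ j ∈ Finset.range (n + 1), F (-j) := by
  induction n with
  | zero => simp
  | succ n ih =>
    rw [Finset.sum_range_succ _ (n + 1), Finset.sum_range_succ _ (n + 1)]
    have := Finset.sum_Icc_succ_eq_add_endpoints F (N := n)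
    push_cast at this ⊢
    rw [this]
    linear_combination ih

/-- `|sin (π t / 2)|`, half the distance of `e^{iπt}` to `1`. -/
def sinHalf (t : ℝ) : ℝ := |Real.sin (Real.pi * t / 2)|

theorem sinHalf_nonneg (t : ℝ) : 0 ≤ sinHalf t := abs_nonneg _

@[fun_prop] theorem continuous_sinHalf : Continuous sinHalf := by unfold sinHalf; fun_prop

theorem sinHalf_periodic : Function.Periodic sinHalf 2 := fun t => by
  rw [sinHalf, sinHalf, show Real.pi * (t + 2) / 2 = Real.pi * t / 2 + Real.pi by ring,
    Real.sin_add_pi, abs_neg]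

/-- Jordan's inequality `|sin x| ≥ (2/π)|x|` at `x = πt/2`. -/
theorem abs_le_sinHalf {t : ℝ} (ht : |t| ≤ 1) : |t| ≤ sinHalf t := by
  have h := Real.mul_abs_le_abs_sin (x := Real.pi * t / 2) (by
    rw [abs_div, abs_mul, abs_of_pos Real.pi_pos, abs_two]
    nlinarith [Real.pi_pos])
  rw [abs_div, abs_mul, abs_of_pos Real.pi_pos, abs_two] at h
  refine le_trans (le_of_eq ?_) h
  field_simp

theorem norm_one_sub_expPi_one (t : ℝ) : ‖1 - expPi 1 t‖ = 2 * sinHalf t := by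
  rw [norm_sub_rev, expPi, mul_comm, Complex.norm_exp_I_mul_ofReal_sub_one, norm_mul, sinHalf,
    Real.norm_eq_abs, Real.norm_eq_abs, abs_two]
  congr 4
  push_cast; ring

/-- The geometric sum `∑_{j < M} e^{iπjt}`. -/
def geo (M : ℕ) (t : ℝ) : ℂ := ∑ j ∈ Finset.range M, expPi j t

@[fun_prop] theorem continuous_geo (M : ℕ) : Continuous (geo M) := by unfold geo; fun_prop

theorem norm_geo_le (M : ℕ) (t : ℝ) : ‖geo M t‖ ≤ M := by
  refine (norm_sum_le _ _).trans ?_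
  simp

theorem norm_geo_mul_sinHalf_le (M : ℕ) (t : ℝ) : ‖geo M t‖ * sinHalf t ≤ 1 := by
  have h : geo M t * (expPi 1 t - 1) = expPi 1 t ^ M - 1 := by
    unfold geo
    simp_rw [expPi_natCast]
    exact geom_sum_mul _ _
  have h2 := congrArg norm h
  rw [norm_mul, norm_sub_rev, norm_one_sub_expPi_one] at h2
  have h3 : ‖expPi 1 t ^ M - 1‖ ≤ 2 := by
    refine (norm_sub_le _ _).trans ?_
    rw [norm_pow, norm_expPi]; norm_num
  linarith

/-- The one-dimensional Dirichlet sum `∑_{|j| ≤ n} e^{iπjt}`. -/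
def dirSum (n : ℕ) (t : ℝ) : ℂ := ∑ j ∈ Finset.Icc (-(n : ℤ)) n, expPi j t

@[fun_prop] theorem continuous_dirSum (M : ℕ) : Continuous (dirSum M) := by
  unfold dirSum; fun_prop

/-- The Fejér identity. -/
theorem sum_dirSum (M : ℕ) (t : ℝ) :
    ∑ n ∈ Finset.range M, dirSum n t = ((‖geo M t‖ ^ 2 : ℝ) : ℂ) := by
  induction M with
  | zero => simp [geo]
  | succ M ih =>
    have e : ∀ M, ((‖geo M t‖ ^ 2 : ℝ) : ℂ) = geo M t * (starRingEnd ℂ) (geo M t) := fun M => by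
      rw [Complex.mul_conj']; push_cast; rfl
    rw [Finset.sum_range_succ, ih, e, e]
    have hc : ∀ M, (starRingEnd ℂ) (geo M t) = ∑ j ∈ Finset.range M, expPi (-j) t := fun M => by
      rw [geo, map_sum]; simp_rw [conj_expPi]
    -- The increment `‖geo (M + 1)‖² - ‖geo M‖²` has to be `dirSum M`. Reversing the summation order
    -- turns its positive and negative halves into the two cross terms of the expanded square.
    have h1 : ∑ j ∈ Finset.range M, expPi ((j : ℤ) + 1) t =
        expPi M t * (starRingEnd ℂ) (geo M t) := by
      rw [hc, Finset.mul_sum, ← Finset.sum_range_reflect]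
      refine Finset.sum_congr rfl fun j hj => ?_
      rw [← expPi_add_left]
      congr 1
      have := Finset.mem_range.1 hj
      omega
    have h2 : ∑ j ∈ Finset.range M, expPi (-((j : ℤ) + 1)) t = expPi (-M) t * geo M t := by
      rw [geo, Finset.mul_sum, ← Finset.sum_range_reflect]
      refine Finset.sum_congr rfl fun j hj => ?_
      rw [← expPi_add_left]
      congr 1
      have := Finset.mem_range.1 hj
      omega
    have h3 := sum_Icc_neg_add M fun k => expPi k t
    rw [Finset.sum_range_succ' _ M, Finset.sum_range_succ' _ M] at h3
    push_cast at h3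
    rw [h1, h2] at h3
    have h4 : geo (M + 1) t = geo M t + expPi M t := Finset.sum_range_succ _ _
    have h5 : expPi M t * expPi (-M) t = 1 := by rw [← expPi_add_left]; simp
    simp only [neg_zero, expPi_zero_left] at h3
    rw [h4, map_add, conj_expPi, dirSum]
    linear_combination h3 - h5

/-- This is the sharp cutoff `m ≤ n`, to be used with `m = ∑ |k_i|` to cut out the `ℓ¹` ball. -/
theorem integral_dirSum_mul (n m : ℕ) :
    ∫ t in (-1 : ℝ)..1, dirSum n t * expPi m t = if m ≤ n then 2 else 0 := by
  simp_rw [dirSum, Finset.sum_mul, ← expPi_add_left]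
  rw [intervalIntegral.integral_finsetSum fun k _ =>
    (continuous_expPi _).intervalIntegrable _ _]
  simp_rw [integral_expPi, add_eq_zero_iff_eq_neg]
  rw [Finset.sum_ite_eq']
  congr 1
  rw [Finset.mem_Icc, eq_iff_iff]
  omega

/-- The trapezoid equal to `1` on `[0, A]` and vanishing at `2 A`. -/
def trap (A k : ℕ) : ℝ := (((2 * A - k : ℕ) : ℝ) - ((A - k : ℕ) : ℝ)) / A

theorem trap_eq_one {A k : ℕ} (hA : 0 < A) (h : k ≤ A) : trap A k = 1 := by
  rw [trap, Nat.cast_sub h, Nat.cast_sub (by omega)]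
  field_simp
  push_cast; ring

theorem abs_trap_le (A k : ℕ) : |trap A k| ≤ 1 := by
  have h1 : ((A - k : ℕ) : ℝ) ≤ ((2 * A - k : ℕ) : ℝ) := by exact_mod_cast (by omega)
  have h2 : ((2 * A - k : ℕ) : ℝ) ≤ A + ((A - k : ℕ) : ℝ) := by exact_mod_cast (by omega)
  rw [trap, abs_of_nonneg (div_nonneg (by linarith) (by positivity))]
  exact div_le_one_of_le₀ (by linarith) (by positivity)

/-- Raising `M` by one adds a full geometric sum to the tent sum, and one factor `1 - z` telescopes
it. -/
theorem sum_tent (M : ℕ) (z : ℂ) :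
    (1 - z) ^ 2 * ∑ k ∈ Finset.range M, ((M - k : ℕ) : ℂ) * z ^ k =
      M - (M + 1) * z + z ^ (M + 1) := by
  induction M with
  | zero => simp
  | succ M ih =>
    have h1 : ∑ k ∈ Finset.range (M + 1), ((M + 1 - k : ℕ) : ℂ) * z ^ k =
        ∑ k ∈ Finset.range M, ((M - k : ℕ) : ℂ) * z ^ k + ∑ k ∈ Finset.range (M + 1), z ^ k := by
      rw [← add_zero (∑ k ∈ Finset.range M, ((M - k : ℕ) : ℂ) * z ^ k)]
      have : (0 : ℂ) = ((M - M : ℕ) : ℂ) * z ^ M := by simp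
      rw [this, ← Finset.sum_range_succ (fun k => ((M - k : ℕ) : ℂ) * z ^ k),
        ← Finset.sum_add_distrib]
      refine Finset.sum_congr rfl fun k hk => ?_
      rw [Nat.succ_sub (by have := Finset.mem_range.1 hk; omega)]
      push_cast; ring
    have h2 := mul_neg_geom_sum z (M + 1)
    rw [h1, mul_add, ih]
    push_cast
    linear_combination (1 - z) * h2

theorem sum_tent_of_le {M n : ℕ} (h : M ≤ n) (z : ℂ) :
    (1 - z) ^ 2 * ∑ k ∈ Finset.range n, ((M - k : ℕ) : ℂ) * z ^ k =
      M - (M + 1) * z + z ^ (M + 1) := by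
  rw [← sum_tent, ← Finset.sum_subset (Finset.range_mono h)]
  intro k _ hk
  rw [Finset.mem_range, not_lt] at hk
  simp [Nat.sub_eq_zero_of_le hk]

/-- The trapezoid is a difference of two tents divided by `A`. The main term is the formal geometric
series, independent of `A`; the piecewise linear cutoff leaves a remainder of order `1 / (A |1 -
z|²)` on the unit circle. -/
theorem sum_trap {A : ℕ} (hA : 0 < A) {z : ℂ} (hz : 1 - z ≠ 0) :
    ∑ k ∈ Finset.range (2 * A + 1), (trap A k : ℂ) * z ^ k =
      1 / (1 - z) + z ^ (A + 1) * (z ^ A - 1) / (A * (1 - z) ^ 2) := by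
  have hA' : (A : ℂ) ≠ 0 := by exact_mod_cast hA.ne'
  have h1 := sum_tent_of_le (M := 2 * A) (n := 2 * A + 1) (by omega) z
  have h2 := sum_tent_of_le (M := A) (n := 2 * A + 1) (by omega) z
  have h3 : (A : ℂ) * ∑ k ∈ Finset.range (2 * A + 1), (trap A k : ℂ) * z ^ k =
      ∑ k ∈ Finset.range (2 * A + 1), ((2 * A - k : ℕ) : ℂ) * z ^ k -
        ∑ k ∈ Finset.range (2 * A + 1), ((A - k : ℕ) : ℂ) * z ^ k := by
    rw [Finset.mul_sum, ← Finset.sum_sub_distrib]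
    refine Finset.sum_congr rfl fun k _ => ?_
    rw [trap]; push_cast; field_simp
  have h4 : (A : ℂ) * (1 - z) ^ 2 * ∑ k ∈ Finset.range (2 * A + 1), (trap A k : ℂ) * z ^ k =
      A * (1 - z) + z ^ (A + 1) * (z ^ A - 1) := by
    push_cast at h1
    linear_combination (1 - z) ^ 2 * h3 + h1 - h2
  rw [← mul_right_inj' (mul_ne_zero hA' (pow_ne_zero 2 hz)), h4]
  field_simp

/-- The kernel with coefficients `w(|k|) e^{iπφ|k|}`, where `w` is the trapezoid. -/
def modKernel (A : ℕ) (φ θ : ℝ) : ℂ :=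
  ∑ k ∈ Finset.Icc (-((2 * A : ℕ) : ℤ)) ((2 * A : ℕ) : ℤ),
    (trap A k.natAbs : ℂ) * expPi k.natAbs φ * expPi k θ

theorem continuous_modKernel (A : ℕ) : Continuous fun p : ℝ × ℝ => modKernel A p.1 p.2 := by
  unfold modKernel; fun_prop

theorem norm_modKernel_le (A : ℕ) (φ θ : ℝ) : ‖modKernel A φ θ‖ ≤ 4 * A + 1 := by
  refine (norm_sum_le_of_le (f := fun k : ℤ =>
    (trap A k.natAbs : ℂ) * expPi k.natAbs φ * expPi k θ) _ (n := fun _ => (1 : ℝ))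
    fun k _ => ?_).trans ?_
  · rw [norm_mul, norm_mul, norm_expPi, norm_expPi, Complex.norm_real, mul_one, mul_one]
    exact abs_trap_le _ _
  · rw [Finset.sum_const, Int.card_Icc, nsmul_eq_mul, mul_one,
      show (((2 * A : ℕ) : ℤ) + 1 - -((2 * A : ℕ) : ℤ)).toNat = 4 * A + 1 by omega]
    push_cast; rfl

/-- On `k ≥ 0` the two phases combine to `φ + θ`, on `k ≤ 0` to `φ - θ`; the term `k = 0` is counted
twice. -/
theorem modKernel_add_one {A : ℕ} (hA : 0 < A) (φ θ : ℝ) : modKernel A φ θ + 1 =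
    ∑ k ∈ Finset.range (2 * A + 1), (trap A k : ℂ) * expPi 1 (φ + θ) ^ k +
      ∑ k ∈ Finset.range (2 * A + 1), (trap A k : ℂ) * expPi 1 (φ - θ) ^ k := by
  have h := sum_Icc_neg_add (2 * A) fun k =>
    (trap A k.natAbs : ℂ) * expPi k.natAbs φ * expPi k θ
  rw [modKernel]
  have h0 : (trap A (0 : ℤ).natAbs : ℂ) * expPi (0 : ℤ).natAbs φ * expPi 0 θ = 1 := by
    simp [trap_eq_one hA (Nat.zero_le _)]
  rw [h0] at h
  rw [h]
  congr 1 <;> refine Finset.sum_congr rfl fun k _ => ?_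
  · rw [← expPi_natCast, expPi_add_right, Int.natAbs_natCast, mul_assoc]
  · rw [← expPi_natCast, sub_eq_add_neg, expPi_add_right, Int.natAbs_neg, Int.natAbs_natCast,
      mul_assoc, expPi_neg_left]

theorem norm_one_sub_mul_le {z w : ℂ} (hz : ‖z‖ = 1) : ‖1 - z * w‖ ≤ ‖1 - z‖ + ‖1 - w‖ := by
  have : 1 - z * w = (1 - z) + z * (1 - w) := by ring
  rw [this]
  refine (norm_add_le _ _).trans ?_
  rw [norm_mul, hz, one_mul]

theorem norm_trap_remainder_le {A : ℕ} (t : ℝ) :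
    ‖expPi 1 t ^ (A + 1) * (expPi 1 t ^ A - 1) / (A * (1 - expPi 1 t) ^ 2)‖ ≤
      1 / (2 * A * sinHalf t ^ 2) := by
  have h3 : ‖expPi 1 t ^ A - 1‖ ≤ 2 := by
    refine (norm_sub_le _ _).trans ?_
    rw [norm_pow, norm_expPi]; norm_num
  rw [norm_div, norm_mul, norm_mul, norm_pow, norm_pow, norm_expPi, norm_one_sub_expPi_one,
    one_pow, one_mul, Complex.norm_natCast]
  have : 1 / (2 * (A : ℝ) * sinHalf t ^ 2) = 2 / (A * (2 * sinHalf t) ^ 2) := by ring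
  rw [this]
  gcongr

/-- The decisive cancellation: `1/(1-z) + 1/(1-w) - 1 = (1-zw)/((1-z)(1-w))`, where `zw = e^{2πiφ}`
does not involve `θ`. The numerator is thus small for small `φ`. -/
theorem norm_modKernel_le_of_pos {A : ℕ} (hA : 0 < A) {φ θ : ℝ} (ha : 0 < sinHalf (φ + θ))
    (hb : 0 < sinHalf (φ - θ)) : ‖modKernel A φ θ‖ ≤
      sinHalf (2 * φ) / (2 * sinHalf (φ + θ) * sinHalf (φ - θ)) +
        1 / (2 * A * sinHalf (φ + θ) ^ 2) + 1 / (2 * A * sinHalf (φ - θ) ^ 2) := by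
  set z := expPi 1 (φ + θ)
  set w := expPi 1 (φ - θ)
  have hz : ‖1 - z‖ = 2 * sinHalf (φ + θ) := norm_one_sub_expPi_one _
  have hw : ‖1 - w‖ = 2 * sinHalf (φ - θ) := norm_one_sub_expPi_one _
  have hz0 : 1 - z ≠ 0 := by rw [← norm_pos_iff, hz]; linarith
  have hw0 : 1 - w ≠ 0 := by rw [← norm_pos_iff, hw]; linarith
  have hzw : ‖1 - z * w‖ = 2 * sinHalf (2 * φ) := by
    rw [← norm_one_sub_expPi_one, ← expPi_add_right]; congr 3; ring
  have h := modKernel_add_one hA φ θ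
  rw [sum_trap hA hz0, sum_trap hA hw0] at h
  have h1 : modKernel A φ θ = (1 - z * w) / ((1 - z) * (1 - w)) +
      z ^ (A + 1) * (z ^ A - 1) / (A * (1 - z) ^ 2) +
      w ^ (A + 1) * (w ^ A - 1) / (A * (1 - w) ^ 2) := by
    have : (1 - z * w) / ((1 - z) * (1 - w)) = 1 / (1 - z) + 1 / (1 - w) - 1 := by
      field_simp; ring
    rw [this]
    linear_combination h
  rw [h1]
  refine (norm_add₃_le).trans ?_
  refine add_le_add_three (le_of_eq ?_) (norm_trap_remainder_le _) (norm_trap_remainder_le _)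
  rw [norm_div, norm_mul, hz, hw, hzw]
  field_simp

theorem sinHalf_two_mul_le (φ θ : ℝ) : sinHalf (2 * φ) ≤ sinHalf (φ + θ) + sinHalf (φ - θ) := by
  have h := norm_one_sub_mul_le (z := expPi 1 (φ + θ)) (w := expPi 1 (φ - θ)) (norm_expPi _ _)
  rw [← expPi_add_right, norm_one_sub_expPi_one, norm_one_sub_expPi_one,
    norm_one_sub_expPi_one, show φ + θ + (φ - θ) = 2 * φ by ring] at h
  linarith

theorem norm_modKernel_le_sum {A : ℕ} (hA : 0 < A) (φ θ : ℝ) : ‖modKernel A φ θ‖ ≤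
    2 * (sinHalf (2 * φ) / ((sinHalf (φ + θ) + (A : ℝ)⁻¹) * (sinHalf (φ - θ) + (A : ℝ)⁻¹))) +
      20 * (A : ℝ)⁻¹ * (((sinHalf (φ + θ) + (A : ℝ)⁻¹) ^ 2)⁻¹ +
        ((sinHalf (φ - θ) + (A : ℝ)⁻¹) ^ 2)⁻¹) := by
  have hA' : (1 : ℝ) ≤ A := by exact_mod_cast hA
  set δ := (A : ℝ)⁻¹ with hδ
  have hδ0 : 0 < δ := by positivity
  have ha := sinHalf_nonneg (φ + θ)
  have hb := sinHalf_nonneg (φ - θ)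
  have hs := sinHalf_nonneg (2 * φ)
  set a := sinHalf (φ + θ)
  set b := sinHalf (φ - θ)
  set σ := sinHalf (2 * φ)
  have hAδ : (A : ℝ) = δ⁻¹ := by rw [hδ, inv_inv]
  -- Next to a singularity the trivial bound `4A + 1 ≤ 5A` suffices: there `x + δ ≤ 2δ`, so the
  -- right-hand side is at least `20δ/(4δ²) = 5A`.
  have small : ∀ x, 0 ≤ x → x < δ → ‖modKernel A φ θ‖ ≤ 20 * δ * ((x + δ) ^ 2)⁻¹ := by
    intro x hx hxδ
    refine (norm_modKernel_le A φ θ).trans ?_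
    have h1 : (x + δ) ^ 2 ≤ 4 * δ ^ 2 := by nlinarith
    have h2 : (4 * δ ^ 2)⁻¹ ≤ ((x + δ) ^ 2)⁻¹ := inv_anti₀ (by positivity) h1
    have h3 : 20 * δ * (4 * δ ^ 2)⁻¹ = 5 * A := by rw [hAδ]; field_simp; norm_num
    nlinarith [mul_le_mul_of_nonneg_left h2 (by positivity : 0 ≤ 20 * δ)]
  have p1 : 0 ≤ 20 * δ * ((a + δ) ^ 2)⁻¹ := by positivity
  have p2 : 0 ≤ 20 * δ * ((b + δ) ^ 2)⁻¹ := by positivity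
  have p3 : 0 ≤ 2 * (σ / ((a + δ) * (b + δ))) := by positivity
  rw [mul_add (20 * δ)]
  rcases lt_or_ge a δ with h | h
  · linarith [small a ha h]
  rcases lt_or_ge b δ with h' | h'
  · linarith [small b hb h']
  have ha0 : 0 < a := by linarith
  have hb0 : 0 < b := by linarith
  refine (norm_modKernel_le_of_pos hA ha0 hb0).trans ?_
  have sq : ∀ x, δ ≤ x → 1 / (2 * A * x ^ 2) ≤ 20 * δ * ((x + δ) ^ 2)⁻¹ := by
    intro x hx
    have hx0 : 0 < x := by linarith
    have h1 : (x + δ) ^ 2 ≤ 4 * x ^ 2 := by nlinarith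
    have h2 : (4 * x ^ 2)⁻¹ ≤ ((x + δ) ^ 2)⁻¹ := inv_anti₀ (by positivity) h1
    have h3 : 1 / (2 * A * x ^ 2) = 2 * δ * (4 * x ^ 2)⁻¹ := by rw [hAδ]; field_simp; norm_num
    rw [h3]
    have := mul_le_mul_of_nonneg_left h2 (by positivity : 0 ≤ 2 * δ)
    have p : 0 ≤ δ * ((x + δ) ^ 2)⁻¹ := by positivity
    linarith
  have hab : σ / (2 * a * b) ≤ 2 * (σ / ((a + δ) * (b + δ))) := by
    have h1 : (a + δ) * (b + δ) ≤ 4 * (a * b) := by nlinarith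
    have h2 : (4 * (a * b))⁻¹ ≤ ((a + δ) * (b + δ))⁻¹ := inv_anti₀ (by positivity) h1
    have h3 : σ / (2 * a * b) = 2 * σ * (4 * (a * b))⁻¹ := by field_simp; norm_num
    rw [h3, div_eq_mul_inv]
    have := mul_le_mul_of_nonneg_left h2 (by positivity : 0 ≤ 2 * σ)
    linarith
  linarith [sq a h, sq b h']

/-! ### Uniform `L¹` bound of the de la Vallée-Poussin kernels -/

/-- Jordan's inequality reduces this to a power integral. An exponent strictly below `-1` gives a
pure power of `δ` at the price `1/ε`, where exponent `-1` would give a logarithm. -/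
theorem integral_sinHalf_rpow_le {δ ε : ℝ} (hδ : 0 < δ) (hε : 0 < ε) :
    ∫ t in (-1 : ℝ)..1, (sinHalf t + δ) ^ (-1 - ε) ≤ 2 / ε * δ ^ (-ε) := by
  have hpos : ∀ t, 0 < sinHalf t + δ := fun t => by have := sinHalf_nonneg t; linarith
  have hpos' : ∀ t : ℝ, 0 < |t| + δ := fun t => by have := abs_nonneg t; linarith
  have c1 : Continuous fun t => (sinHalf t + δ) ^ (-1 - ε) :=
    (continuous_sinHalf.add continuous_const).rpow_const fun t => .inl (hpos t).ne'
  have c2 : Continuous fun t : ℝ => (|t| + δ) ^ (-1 - ε) :=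
    (continuous_abs.add continuous_const).rpow_const fun t => .inl (hpos' t).ne'
  have h1 : ∫ t in (-1 : ℝ)..1, (sinHalf t + δ) ^ (-1 - ε) ≤
      ∫ t in (-1 : ℝ)..1, (|t| + δ) ^ (-1 - ε) := by
    refine intervalIntegral.integral_mono_on (by norm_num) (c1.intervalIntegrable _ _)
      (c2.intervalIntegrable _ _) fun t ht => ?_
    exact Real.rpow_le_rpow_of_nonpos (hpos' t)
      (by linarith [abs_le_sinHalf (abs_le.2 ht)]) (by linarith)
  have h2 : ∫ t in (0 : ℝ)..1, (|t| + δ) ^ (-1 - ε) ≤ 1 / ε * δ ^ (-ε) := by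
    have e : ∫ t in (0 : ℝ)..1, (|t| + δ) ^ (-1 - ε) = ∫ t in (0 : ℝ)..1, (t + δ) ^ (-1 - ε) := by
      refine intervalIntegral.integral_congr fun t ht => ?_
      rw [Set.uIcc_of_le zero_le_one] at ht
      simp only [abs_of_nonneg ht.1]
    rw [e, intervalIntegral.integral_comp_add_right (fun t => t ^ (-1 - ε)),
      integral_rpow (.inr ⟨by linarith, by
        rw [Set.uIcc_of_le (by linarith)]; rintro ⟨h, -⟩; linarith⟩)]
    rw [show -1 - ε + 1 = -ε by ring, zero_add]
    have : ((1 + δ) ^ (-ε) - δ ^ (-ε)) / -ε = 1 / ε * δ ^ (-ε) - (1 + δ) ^ (-ε) / ε := by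
      field_simp; ring
    rw [this]
    have : 0 ≤ (1 + δ) ^ (-ε) / ε := by positivity
    linarith
  have h3 : ∫ t in (-1 : ℝ)..0, (|t| + δ) ^ (-1 - ε) =
      ∫ t in (0 : ℝ)..1, (|t| + δ) ^ (-1 - ε) := by
    have := intervalIntegral.integral_comp_neg (a := 0) (b := 1)
      fun t : ℝ => (|t| + δ) ^ (-1 - ε)
    simp only [abs_neg, neg_zero] at this
    exact this.symm
  rw [← intervalIntegral.integral_add_adjacent_intervals (b := 0) (c2.intervalIntegrable _ _)
    (c2.intervalIntegrable _ _), h3] at h1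
  calc _ ≤ _ := h1
    _ ≤ 1 / ε * δ ^ (-ε) + 1 / ε * δ ^ (-ε) := add_le_add h2 h2
    _ = _ := by ring

/-- For `a ≤ b` one has `σ ≤ 2b`, so `σ ≤ σ^ε (2b)^{1-ε}`, and `b^{-ε} ≤ a^{-ε}` then removes `b`.
This separates the two singularities, so that each can be integrated in `θ` by itself. -/
theorem div_mul_le_rpow {σ a b ε : ℝ} (hσ : 0 ≤ σ) (ha : 0 < a) (hb : 0 < b) (hab : σ ≤ a + b)
    (hε : 0 < ε) (hε1 : ε ≤ 1) :
    σ / (a * b) ≤ 2 * σ ^ ε * (a ^ (-1 - ε) + b ^ (-1 - ε)) := by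
  wlog h : a ≤ b generalizing a b
  · have := this hb ha (by linarith) (le_of_not_ge h)
    rwa [mul_comm b a, add_comm (b ^ _)] at this
  rcases hσ.eq_or_lt with rfl | hσ0
  · rw [zero_div]; positivity
  have h1 : σ ≤ σ ^ ε * (2 * b ^ (1 - ε)) := by
    calc σ = σ ^ ε * σ ^ (1 - ε) := by rw [← Real.rpow_add hσ0]; simp
      _ ≤ σ ^ ε * (2 * b) ^ (1 - ε) := by gcongr; linarith
      _ = σ ^ ε * (2 ^ (1 - ε) * b ^ (1 - ε)) := by rw [Real.mul_rpow (by norm_num) hb.le]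
      _ ≤ σ ^ ε * (2 ^ (1 : ℝ) * b ^ (1 - ε)) := by
        gcongr
        · norm_num
        · linarith
      _ = _ := by rw [Real.rpow_one]
  have h2 : b ^ (1 - ε) / b ≤ a ^ (-ε) := by
    rw [Real.rpow_sub hb, Real.rpow_one, Real.rpow_neg ha.le, div_div, mul_comm, ← div_div,
      div_self hb.ne', one_div]
    gcongr
  have h3 : a ^ (-1 - ε) = a⁻¹ * a ^ (-ε) := by
    rw [sub_eq_add_neg, Real.rpow_add ha, Real.rpow_neg_one]
  calc σ / (a * b) ≤ σ ^ ε * (2 * b ^ (1 - ε)) / (a * b) := by gcongr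
    _ = 2 * σ ^ ε * (a⁻¹ * (b ^ (1 - ε) / b)) := by field_simp
    _ ≤ 2 * σ ^ ε * (a⁻¹ * a ^ (-ε)) := by gcongr
    _ ≤ _ := by
      rw [h3]
      have : 0 ≤ b ^ (-1 - ε) := by positivity
      have : 0 ≤ 2 * σ ^ ε := by positivity
      gcongr
      linarith

theorem norm_modKernel_le_rpow {A : ℕ} (hA : 0 < A) {ε : ℝ} (hε : 0 < ε) (hε1 : ε ≤ 1)
    (φ θ : ℝ) : ‖modKernel A φ θ‖ ≤ (4 * sinHalf (2 * φ) ^ ε + 20 * (A : ℝ)⁻¹ ^ ε) *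
      ((sinHalf (φ + θ) + (A : ℝ)⁻¹) ^ (-1 - ε) + (sinHalf (φ - θ) + (A : ℝ)⁻¹) ^ (-1 - ε)) := by
  refine (norm_modKernel_le_sum hA φ θ).trans ?_
  set δ := (A : ℝ)⁻¹ with hδ
  have hδ0 : 0 < δ := by have : (0 : ℝ) < A := by exact_mod_cast hA
                         positivity
  have ha := sinHalf_nonneg (φ + θ)
  have hb := sinHalf_nonneg (φ - θ)
  have hs := sinHalf_nonneg (2 * φ)
  have h1 := div_mul_le_rpow hs (a := sinHalf (φ + θ) + δ) (b := sinHalf (φ - θ) + δ)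
    (by linarith) (by linarith) (by linarith [sinHalf_two_mul_le φ θ]) hε hε1
  have h2 : ∀ x, 0 ≤ x → δ * ((x + δ) ^ 2)⁻¹ ≤ δ ^ ε * (x + δ) ^ (-1 - ε) := by
    intro x hx
    have hp : 0 < x + δ := by linarith
    calc δ * ((x + δ) ^ 2)⁻¹ = δ ^ ε * δ ^ (1 - ε) * ((x + δ) ^ 2)⁻¹ := by
          rw [← Real.rpow_add hδ0]; simp
      _ ≤ δ ^ ε * (x + δ) ^ (1 - ε) * ((x + δ) ^ 2)⁻¹ := by gcongr; linarith
      _ = δ ^ ε * (x + δ) ^ (-1 - ε) := by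
        rw [mul_assoc, ← Real.rpow_natCast, ← Real.rpow_neg hp.le, ← Real.rpow_add hp]
        congr 2; push_cast; ring
  linarith [h2 _ ha, h2 _ hb]

/-- By periodicity the shifts by `φ` drop out of the integrals, and `δ^{-ε} = A^ε` turns `σ^ε` into
`(Aσ)^ε`. The constant is `96 = 16 + 80`, each part being `2 · 2` times a coefficient of the
pointwise bound. -/
theorem integral_norm_modKernel_le {A : ℕ} (hA : 0 < A) {ε : ℝ} (hε : 0 < ε) (hε1 : ε ≤ 1)
    (φ : ℝ) : ∫ θ in (-1 : ℝ)..1, ‖modKernel A φ θ‖ ≤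
      96 / ε * (1 + A * sinHalf (2 * φ)) ^ ε := by
  have hA' : (0 : ℝ) < A := by exact_mod_cast hA
  set δ := (A : ℝ)⁻¹ with hδ
  have hδ0 : 0 < δ := by positivity
  set F : ℝ → ℝ := fun t => (sinHalf t + δ) ^ (-1 - ε) with hF
  have hpos : ∀ t, 0 < sinHalf t + δ := fun t => by have := sinHalf_nonneg t; linarith
  have c1 : Continuous F :=
    (continuous_sinHalf.add continuous_const).rpow_const fun t => .inl (hpos t).ne'
  have hper : Function.Periodic F 2 := fun t => by
    rw [hF]; dsimp only; rw [sinHalf_periodic]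
  have hI := integral_sinHalf_rpow_le hδ0 hε
  have t1 : ∫ θ in (-1 : ℝ)..1, F (φ + θ) = ∫ θ in (-1 : ℝ)..1, F θ := by
    rw [intervalIntegral.integral_comp_add_left F]
    have := hper.intervalIntegral_add_eq (φ + -1) (-1)
    rw [show φ + -1 + 2 = φ + 1 by ring, show (-1 : ℝ) + 2 = 1 by norm_num] at this
    exact this
  have t2 : ∫ θ in (-1 : ℝ)..1, F (φ - θ) = ∫ θ in (-1 : ℝ)..1, F θ := by
    rw [intervalIntegral.integral_comp_sub_left F]
    have := hper.intervalIntegral_add_eq (φ - 1) (-1)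
    rw [show φ - 1 + 2 = φ - -1 by ring, show (-1 : ℝ) + 2 = 1 by norm_num] at this
    exact this
  have cm : Continuous fun θ => ‖modKernel A φ θ‖ :=
    ((continuous_modKernel A).comp (by fun_prop : Continuous fun θ : ℝ => (φ, θ))).norm
  set c := 4 * sinHalf (2 * φ) ^ ε + 20 * δ ^ ε
  have hs := sinHalf_nonneg (2 * φ)
  have hc : 0 ≤ c := by positivity
  calc ∫ θ in (-1 : ℝ)..1, ‖modKernel A φ θ‖
      ≤ ∫ θ in (-1 : ℝ)..1, c * (F (φ + θ) + F (φ - θ)) := by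
        refine intervalIntegral.integral_mono_on (by norm_num) (cm.intervalIntegrable _ _)
          (Continuous.intervalIntegrable (by fun_prop) _ _)
          fun θ _ => norm_modKernel_le_rpow hA hε hε1 φ θ
    _ = c * (2 * ∫ θ in (-1 : ℝ)..1, F θ) := by
        rw [intervalIntegral.integral_const_mul, intervalIntegral.integral_add
          (Continuous.intervalIntegrable (by fun_prop) _ _)
          (Continuous.intervalIntegrable (by fun_prop) _ _), t1, t2]
        ring
    _ ≤ c * (2 * (2 / ε * δ ^ (-ε))) := by gcongr
    _ = (16 * (A * sinHalf (2 * φ)) ^ ε + 80) / ε := by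
        have e1 : δ ^ (-ε) = (A : ℝ) ^ ε := by
          rw [hδ, Real.inv_rpow hA'.le, Real.rpow_neg hA'.le, inv_inv]
        have e2 : δ ^ ε * (A : ℝ) ^ ε = 1 := by
          rw [← Real.mul_rpow hδ0.le hA'.le, hδ, inv_mul_cancel₀ hA'.ne', Real.one_rpow]
        rw [e1, Real.mul_rpow hA'.le hs]
        field_simp
        linear_combination 80 * e2
    _ ≤ (16 * (1 + A * sinHalf (2 * φ)) ^ ε + 80 * (1 + A * sinHalf (2 * φ)) ^ ε) / ε := by
        have p : 0 ≤ A * sinHalf (2 * φ) := by positivity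
        have q : 1 ≤ (1 + A * sinHalf (2 * φ)) ^ ε := Real.one_le_rpow (by linarith) hε.le
        gcongr
        · linarith
        · linarith
    _ = _ := by ring

/-- The Dirichlet kernel of the `ℓ¹` ball as a superposition of products of one-dimensional
kernels. -/
theorem dirichletKernel_eq_integral {A n : ℕ} (hA : 0 < A) (hn : n ≤ A) (θ : Fin d → ℝ) :
    (dirichletKernel d n θ : ℂ) = ((2 : ℂ) ^ d)⁻¹ *
      (2⁻¹ * ∫ φ in (-1 : ℝ)..1, dirSum n φ * ∏ i, modKernel A φ (θ i)) := by
  rw [ofReal_dirichletKernel]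
  congr 1
  set B := Fintype.piFinset fun _ : Fin d =>
    Finset.Icc (-((2 * A : ℕ) : ℤ)) ((2 * A : ℕ) : ℤ) with hB
  -- Expanding the product over the box, the modulations multiply to a single phase of frequency `∑
  -- |k_i|`.
  have h1 : ∀ φ, dirSum n φ * ∏ i, modKernel A φ (θ i) = ∑ k ∈ B,
      ((∏ i, (trap A (k i).natAbs : ℂ)) * chr k θ) *
        (dirSum n φ * expPi ((∑ i, (k i).natAbs : ℕ) : ℤ) φ) := fun φ => by
    simp only [modKernel]
    rw [Finset.prod_univ_sum, Finset.mul_sum]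
    refine Finset.sum_congr rfl fun k _ => ?_
    have : expPi ((∑ i, (k i).natAbs : ℕ) : ℤ) φ = ∏ i, expPi (k i).natAbs φ := by
      simp_rw [expPi_natCast, Finset.prod_pow_eq_pow_sum]
    rw [this, Finset.prod_mul_distrib, Finset.prod_mul_distrib, chr]
    ring
  simp_rw [h1]
  rw [intervalIntegral.integral_finsetSum fun k _ =>
    Continuous.intervalIntegrable (by fun_prop) _ _]
  simp_rw [intervalIntegral.integral_const_mul, integral_dirSum_mul]
  rw [Finset.mul_sum]
  have hfreq : ∀ k : Fin d → ℤ, k ∈ freq d n ↔ ∑ i, (k i).natAbs ≤ n := fun k => by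
    rw [mem_freq]
    simp_rw [Int.abs_eq_natAbs]
    exact_mod_cast Iff.rfl
  have hle : ∀ k ∈ freq d n, ∀ i, (k i).natAbs ≤ n := fun k hk i =>
    (Finset.single_le_sum (f := fun i => (k i).natAbs) (fun _ _ => Nat.zero_le _)
      (Finset.mem_univ i)).trans ((hfreq k).1 hk)
  have hsub : freq d n ⊆ B := fun k hk => by
    rw [hB, Fintype.mem_piFinset]
    intro i
    have := hle k hk i
    rw [Finset.mem_Icc]
    omega
  -- Inside the `ℓ¹` ball `|k_i| ≤ n ≤ A`, so all trapezoid weights are `1`; elsewhere in the box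
  -- the cutoff integral vanishes.
  rw [← Finset.sum_subset hsub]
  · refine Finset.sum_congr rfl fun k hk => ?_
    rw [if_pos ((hfreq k).1 hk), Finset.prod_eq_one fun i _ => by
      rw [trap_eq_one hA ((hle k hk i).trans hn), Complex.ofReal_one]]
    ring
  · intro k _ hk
    rw [hfreq] at hk
    rw [if_neg hk]; ring

/-- The de la Vallée-Poussin average of the one-dimensional Dirichlet sums. -/
def vpSum (N : ℕ) (φ : ℝ) : ℂ :=
  (((N / 2 : ℕ) : ℂ) + 1)⁻¹ * ∑ n ∈ Finset.Icc (N / 2) N, dirSum n φ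

@[fun_prop] theorem continuous_vpSum (N : ℕ) : Continuous (vpSum N) := by
  unfold vpSum; fun_prop

/-- The sum of the Dirichlet sums from `N/2` to `N` is a difference of two Fejér sums, `‖geo (N +
1)‖² - ‖geo (N / 2)‖²`, each with quadratic decay. -/
theorem norm_vpSum_le {N : ℕ} (hN : 0 < N) (φ : ℝ) :
    ‖vpSum N φ‖ ≤ 36 / N * ((sinHalf φ + (N : ℝ)⁻¹) ^ 2)⁻¹ := by
  have hN' : (1 : ℝ) ≤ N := by exact_mod_cast hN
  have hs := sinHalf_nonneg φ
  set δ := (N : ℝ)⁻¹ with hδ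
  have hδ0 : 0 < δ := by positivity
  have hNδ : N * δ = 1 := mul_inv_cancel₀ (by linarith)
  have hgeo : ∀ M : ℕ, M ≤ 2 * N → ‖geo M φ‖ ^ 2 ≤ 9 * ((sinHalf φ + δ) ^ 2)⁻¹ := by
    intro M hM
    -- `3 = 1 + 2`: the telescoping bound, plus `2Nδ = 2` from counting terms.
    have h1 : ‖geo M φ‖ * (sinHalf φ + δ) ≤ 3 := by
      have h2 := norm_geo_mul_sinHalf_le M φ
      have h3 : ‖geo M φ‖ ≤ 2 * N := (norm_geo_le M φ).trans (by exact_mod_cast hM)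
      nlinarith [mul_le_mul_of_nonneg_right h3 hδ0.le]
    have hp : 0 < sinHalf φ + δ := by linarith
    rw [← div_eq_mul_inv, le_div_iff₀ (by positivity), ← mul_pow]
    have := norm_nonneg (geo M φ)
    nlinarith [mul_nonneg this hp.le]
  have hsum : ∑ n ∈ Finset.Icc (N / 2) N, dirSum n φ =
      ((‖geo (N + 1) φ‖ ^ 2 : ℝ) : ℂ) - ((‖geo (N / 2) φ‖ ^ 2 : ℝ) : ℂ) := by
    rw [← sum_dirSum, ← sum_dirSum, ← Finset.sum_Ico_eq_sub _ (by omega)]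
    congr 1
  rw [vpSum, hsum, norm_mul, norm_inv]
  have h1 : ‖(((N / 2 : ℕ) : ℂ) + 1)‖ = ((N / 2 : ℕ) : ℝ) + 1 := by
    rw [← Nat.cast_succ, Complex.norm_natCast, Nat.cast_succ]
  have h2 : (N : ℝ) / 2 ≤ ((N / 2 : ℕ) : ℝ) + 1 := by
    have : N ≤ 2 * (N / 2 + 1) := by omega
    have : (N : ℝ) ≤ 2 * (((N / 2 : ℕ) : ℝ) + 1) := by exact_mod_cast this
    linarith
  have h3 : (((N / 2 : ℕ) : ℝ) + 1)⁻¹ ≤ 2 / N := by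
    rw [← inv_div]; exact inv_anti₀ (by linarith) h2
  have h4 : ‖((‖geo (N + 1) φ‖ ^ 2 : ℝ) : ℂ) - ((‖geo (N / 2) φ‖ ^ 2 : ℝ) : ℂ)‖ ≤
      18 * ((sinHalf φ + δ) ^ 2)⁻¹ := by
    refine (norm_sub_le _ _).trans ?_
    rw [Complex.norm_real, Complex.norm_real, Real.norm_of_nonneg (by positivity),
      Real.norm_of_nonneg (by positivity)]
    linarith [hgeo (N + 1) (by omega), hgeo (N / 2) (by omega)]
  rw [h1]
  calc _ ≤ 2 / (N : ℝ) * (18 * ((sinHalf φ + δ) ^ 2)⁻¹) := by gcongr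
    _ = _ := by ring

/-- The trapezoid with `A = N` serves all averaged `n` at once, so the average falls on the
`φ`-factor only. -/
theorem vpKernel_eq_integral {N : ℕ} (hN : 0 < N) (θ : Fin d → ℝ) :
    (vpKernel d N θ : ℂ) = ((2 : ℂ) ^ d)⁻¹ *
      (2⁻¹ * ∫ φ in (-1 : ℝ)..1, vpSum N φ * ∏ i, modKernel N φ (θ i)) := by
  have hc : Continuous fun φ => ∏ i, modKernel N φ (θ i) := by unfold modKernel; fun_prop
  have h1 : ∀ n ∈ Finset.Icc (N / 2) N, (dirichletKernel d n θ : ℂ) = ((2 : ℂ) ^ d)⁻¹ *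
      (2⁻¹ * ∫ φ in (-1 : ℝ)..1, dirSum n φ * ∏ i, modKernel N φ (θ i)) := fun n hn =>
    dirichletKernel_eq_integral hN (Finset.mem_Icc.1 hn).2 θ
  generalize hP : (fun φ => ∏ i, modKernel N φ (θ i)) = P at hc
  simp only [fun φ => congrFun hP φ] at h1 ⊢
  have h2 : ∀ φ, vpSum N φ * P φ = (((N / 2 : ℕ) : ℂ) + 1)⁻¹ *
      ∑ n ∈ Finset.Icc (N / 2) N, dirSum n φ * P φ := fun φ => by
    rw [vpSum, mul_assoc, Finset.sum_mul]
  simp_rw [h2]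
  rw [intervalIntegral.integral_const_mul, intervalIntegral.integral_finsetSum fun k _ =>
    Continuous.intervalIntegrable (by fun_prop) _ _, vpKernel]
  push_cast
  rw [Finset.sum_congr rfl h1, ← Finset.mul_sum, ← Finset.mul_sum]
  ring

theorem sinHalf_two_mul_le_two (φ : ℝ) : sinHalf (2 * φ) ≤ 2 * sinHalf φ := by
  have := sinHalf_two_mul_le φ 0
  rw [add_zero, sub_zero] at this
  linarith

theorem integral_norm_vpSum_mul_prod_le (hd : 0 < d) {N : ℕ} (hN : 0 < N) :
    ∫ φ in (-1 : ℝ)..1, ‖vpSum N φ‖ * ∏ _i : Fin d, ∫ θ in (-1 : ℝ)..1, ‖modKernel N φ θ‖ ≤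
      288 * (192 * d) ^ d := by
  have hd' : (1 : ℝ) ≤ d := by exact_mod_cast hd
  have hN' : (1 : ℝ) ≤ N := by exact_mod_cast hN
  set δ := (N : ℝ)⁻¹ with hδ
  have hδ0 : 0 < δ := by positivity
  have hNδ : N * δ = 1 := mul_inv_cancel₀ (by linarith)
  -- With this `ε` the `d` factors multiply to the power `1/2`. Against the decay `x⁻²` there
  -- remains `N^{-1/2} x^{-3/2}`, whose integral is bounded uniformly in `N`.
  set ε : ℝ := (2 * d : ℝ)⁻¹ with hε
  have hε0 : 0 < ε := by positivity
  have hε1 : ε ≤ 1 := inv_le_one_of_one_le₀ (by linarith)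
  have hpos : ∀ t, 0 < sinHalf t + δ := fun t => by have := sinHalf_nonneg t; linarith
  have c1 : Continuous fun t => (sinHalf t + δ) ^ (-1 - (1 / 2 : ℝ)) :=
    (continuous_sinHalf.add continuous_const).rpow_const fun t => .inl (hpos t).ne'
  have key : ∀ φ, ‖vpSum N φ‖ * ∏ _i : Fin d, ∫ θ in (-1 : ℝ)..1, ‖modKernel N φ θ‖ ≤
      72 * (192 * d : ℝ) ^ d * (N : ℝ) ^ (-(1 / 2) : ℝ) *
        (sinHalf φ + δ) ^ (-1 - (1 / 2 : ℝ)) := by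
    intro φ
    have hs := sinHalf_nonneg (2 * φ)
    set x := sinHalf φ + δ with hx
    have hx0 : 0 < x := hpos φ
    have h1 : 1 + N * sinHalf (2 * φ) ≤ 2 * N * x := by
      nlinarith [sinHalf_two_mul_le_two φ, sinHalf_nonneg φ]
    have h2 : ∏ _i : Fin d, ∫ θ in (-1 : ℝ)..1, ‖modKernel N φ θ‖ ≤
        (192 * d : ℝ) ^ d * (2 * N * x) ^ (1 / 2 : ℝ) := by
      rw [Finset.prod_const, Finset.card_univ, Fintype.card_fin]
      have h3 : ∫ θ in (-1 : ℝ)..1, ‖modKernel N φ θ‖ ≤ (192 * d) * (2 * N * x) ^ ε := by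
        refine (integral_norm_modKernel_le hN hε0 hε1 φ).trans ?_
        have : 96 / ε = 192 * d := by rw [hε]; field_simp; norm_num
        rw [this]
        gcongr
      have h4 : 0 ≤ ∫ θ in (-1 : ℝ)..1, ‖modKernel N φ θ‖ :=
        intervalIntegral.integral_nonneg (by norm_num) fun θ _ => norm_nonneg _
      refine (pow_le_pow_left₀ h4 h3 d).trans (le_of_eq ?_)
      rw [mul_pow, ← Real.rpow_mul_natCast (by positivity)]
      congr 2
      rw [hε]; field_simp
    have h5 : (2 * N * x) ^ (1 / 2 : ℝ) ≤ 2 * ((N : ℝ) ^ (1 / 2 : ℝ) * x ^ (1 / 2 : ℝ)) := by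
      rw [Real.mul_rpow (by positivity) hx0.le, Real.mul_rpow (by norm_num) (by positivity),
        mul_assoc]
      gcongr
      calc (2 : ℝ) ^ (1 / 2 : ℝ) ≤ 2 ^ (1 : ℝ) := by
            gcongr <;> norm_num
        _ = 2 := Real.rpow_one 2
    calc _ ≤ (36 / N * (x ^ 2)⁻¹) * ((192 * d : ℝ) ^ d * (2 * N * x) ^ (1 / 2 : ℝ)) := by
          refine mul_le_mul (norm_vpSum_le hN φ) h2 ?_ (by positivity)
          exact Finset.prod_nonneg fun i _ =>
            intervalIntegral.integral_nonneg (by norm_num) fun θ _ => norm_nonneg _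
      _ ≤ (36 / N * (x ^ 2)⁻¹) * ((192 * d : ℝ) ^ d *
          (2 * ((N : ℝ) ^ (1 / 2 : ℝ) * x ^ (1 / 2 : ℝ)))) := by gcongr
      _ = 72 * (192 * d : ℝ) ^ d * ((N : ℝ)⁻¹ * (N : ℝ) ^ (1 / 2 : ℝ)) *
          ((x ^ 2)⁻¹ * x ^ (1 / 2 : ℝ)) := by ring
      _ = _ := by
        have hN0 : (0 : ℝ) < N := by linarith
        have e1 : (N : ℝ)⁻¹ * (N : ℝ) ^ (1 / 2 : ℝ) = (N : ℝ) ^ (-(1 / 2) : ℝ) := by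
          rw [← Real.rpow_neg_one, ← Real.rpow_add hN0]; norm_num
        have e2 : (x ^ 2)⁻¹ * x ^ (1 / 2 : ℝ) = x ^ (-1 - (1 / 2 : ℝ)) := by
          rw [← Real.rpow_natCast, ← Real.rpow_neg hx0.le, ← Real.rpow_add hx0]; norm_num
        rw [e1, e2]
  have hI := integral_sinHalf_rpow_le hδ0 (ε := 1 / 2) (by norm_num)
  calc _ ≤ ∫ φ in (-1 : ℝ)..1, 72 * (192 * d : ℝ) ^ d * (N : ℝ) ^ (-(1 / 2) : ℝ) *
        (sinHalf φ + δ) ^ (-1 - (1 / 2 : ℝ)) := by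
        refine intervalIntegral.integral_mono_on (by norm_num)
          (Continuous.intervalIntegrable ?_ _ _)
          (Continuous.intervalIntegrable (by fun_prop) _ _) fun φ _ => key φ
        refine (continuous_vpSum N).norm.mul (continuous_finsetProd _ fun i _ => ?_)
        exact intervalIntegral.continuous_parametric_intervalIntegral_of_continuous'
          (f := fun φ θ => ‖modKernel N φ θ‖) (continuous_modKernel N).norm _ _
    _ ≤ 72 * (192 * d : ℝ) ^ d * (N : ℝ) ^ (-(1 / 2) : ℝ) *
        (2 / (1 / 2) * δ ^ (-(1 / 2) : ℝ)) := by
        rw [intervalIntegral.integral_const_mul]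
        gcongr
    _ = 288 * (192 * d) ^ d * ((N : ℝ) ^ (-(1 / 2) : ℝ) * δ ^ (-(1 / 2) : ℝ)) := by ring
    _ = _ := by
      rw [← Real.mul_rpow (by positivity) hδ0.le, hNδ, Real.one_rpow, mul_one]

/-- The de la Vallée-Poussin kernels of the `ℓ¹` ball are bounded in `L¹`. -/
theorem l1Norm_vpKernel_le (hd : 0 < d) {N : ℕ} (hN : 0 < N) :
    l1Norm (vpKernel d N) ≤ 288 * (192 * d) ^ d := by
  have hcQ : Continuous fun p : (Fin d → ℝ) × ℝ => ∏ i, ‖modKernel N p.2 (p.1 i)‖ :=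
    continuous_finsetProd _ fun i _ => ((continuous_modKernel N).comp
      (by fun_prop : Continuous fun p : (Fin d → ℝ) × ℝ => (p.2, p.1 i))).norm
  have hcF : Continuous fun p : (Fin d → ℝ) × ℝ =>
      ‖vpSum N p.2‖ * ∏ i, ‖modKernel N p.2 (p.1 i)‖ := by fun_prop
  have h1 : ∀ θ : Fin d → ℝ, |vpKernel d N θ| ≤
      ∫ φ in (-1 : ℝ)..1, ‖vpSum N φ‖ * ∏ i, ‖modKernel N φ (θ i)‖ := by
    intro θ
    rw [← Real.norm_eq_abs, ← Complex.norm_real, vpKernel_eq_integral hN, norm_mul, norm_mul, norm_inv, norm_pow,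
      norm_inv, Complex.norm_ofNat]
    have h2 : ‖∫ φ in (-1 : ℝ)..1, vpSum N φ * ∏ i, modKernel N φ (θ i)‖ ≤
        ∫ φ in (-1 : ℝ)..1, ‖vpSum N φ‖ * ∏ i, ‖modKernel N φ (θ i)‖ := by
      refine (intervalIntegral.norm_integral_le_integral_norm (by norm_num)).trans (le_of_eq ?_)
      simp only [norm_mul, norm_prod]
    have h3 : ((2 : ℝ) ^ d)⁻¹ ≤ 1 := inv_le_one_of_one_le₀ (one_le_pow₀ (by norm_num))
    have h4 := norm_nonneg (∫ φ in (-1 : ℝ)..1, vpSum N φ * ∏ i, modKernel N φ (θ i))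
    have h5 : 0 ≤ ((2 : ℝ) ^ d)⁻¹ := by positivity
    nlinarith
  have hint : Integrable (fun p : (Fin d → ℝ) × ℝ =>
      ‖vpSum N p.2‖ * ∏ i, ‖modKernel N p.2 (p.1 i)‖)
      ((volume.restrict (cube d)).prod (volume.restrict (Set.Icc (-1 : ℝ) 1))) := by
    rw [Measure.prod_restrict]
    exact hcF.continuousOn.integrableOn_compact (isCompact_cube.prod isCompact_Icc)
  have hII : ∀ g : ℝ → ℝ, ∫ φ in (-1 : ℝ)..1, g φ = ∫ φ in Set.Icc (-1 : ℝ) 1, g φ := fun g => by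
    rw [intervalIntegral.integral_of_le (by norm_num), integral_Icc_eq_integral_Ioc]
  -- Fubini: for fixed `φ` the integral over the cube factors into `d` equal one-dimensional `L¹`
  -- norms.
  calc l1Norm (vpKernel d N)
      ≤ ∫ θ in cube d, ∫ φ in Set.Icc (-1 : ℝ) 1,
          ‖vpSum N φ‖ * ∏ i, ‖modKernel N φ (θ i)‖ := by
        refine integral_mono (integrableOn_cube
          (continuous_of_mem_trigPoly (vpKernel_mem_trigPoly N)).abs) hint.integral_prod_left
          fun θ => ?_
        rw [← hII]; exact h1 θ
    _ = ∫ φ in Set.Icc (-1 : ℝ) 1, ∫ θ in cube d,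
          ‖vpSum N φ‖ * ∏ i, ‖modKernel N φ (θ i)‖ := integral_integral_swap hint
    _ = ∫ φ in (-1 : ℝ)..1, ‖vpSum N φ‖ *
          ∏ _i : Fin d, ∫ θ in (-1 : ℝ)..1, ‖modKernel N φ θ‖ := by
        rw [hII]
        refine integral_congr_ae (.of_forall fun φ => ?_)
        dsimp only
        rw [integral_const_mul, integral_cube_prod fun _ θ => ‖modKernel N φ θ‖]
    _ ≤ _ := integral_norm_vpSum_mul_prod_le hd hN

/-! ### Jackson kernels -/

theorem mul_mem_trigSpan {M N : ℕ} {u v : (Fin d → ℝ) → ℂ} (hu : u ∈ trigSpan d M)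
    (hv : v ∈ trigSpan d N) : u * v ∈ trigSpan d (M + N) := by
  induction hu using Submodule.span_induction with
  | mem u h =>
    obtain ⟨k, hk, rfl⟩ := h
    induction hv using Submodule.span_induction with
    | mem v h =>
      obtain ⟨l, hl, rfl⟩ := h
      have : chr k * chr l = chr (k + l) := by ext x; rw [chr_add_left]; rfl
      rw [this]
      refine chr_mem_trigSpan ?_
      rw [Finset.mem_coe, mem_freq] at hk hl
      rw [mem_freq]
      push_cast
      refine (Finset.sum_le_sum fun i _ => abs_add_le (k i) (l i)).trans ?_
      rw [Finset.sum_add_distrib]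
      exact add_le_add hk hl
    | zero => rw [mul_zero]; exact Submodule.zero_mem _
    | add x y _ _ hx hy => rw [mul_add]; exact Submodule.add_mem _ hx hy
    | smul a x _ hx => rw [mul_smul_comm]; exact Submodule.smul_mem _ _ hx
  | zero => rw [zero_mul]; exact Submodule.zero_mem _
  | add x y _ _ hx hy => rw [add_mul]; exact Submodule.add_mem _ hx hy
  | smul a x _ hx => rw [smul_mul_assoc]; exact Submodule.smul_mem _ _ hx

theorem prod_mem_trigSpan {N : ℕ} (S : Finset (Fin d)) {u : Fin d → (Fin d → ℝ) → ℂ}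
    (hu : ∀ i, u i ∈ trigSpan d N) : ∏ i ∈ S, u i ∈ trigSpan d (S.card * N) := by
  induction S using Finset.induction_on with
  | empty =>
    have : (1 : (Fin d → ℝ) → ℂ) = chr 0 := by ext z; simp [chr]
    rw [Finset.prod_empty, this]
    exact chr_mem_trigSpan (by rw [mem_freq]; simp)
  | insert i S hi ih =>
    rw [Finset.prod_insert hi, Finset.card_insert_of_notMem hi, add_comm, add_mul, one_mul]
    exact mul_mem_trigSpan (hu i) ih

theorem expPi_coord_mem_trigSpan {N : ℕ} {k : ℤ} (hk : |k| ≤ N) (i : Fin d) :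
    (fun x : Fin d → ℝ => expPi k (x i)) ∈ trigSpan d N := by
  have : (fun x : Fin d → ℝ => expPi k (x i)) = chr (Pi.single i k) := by
    ext x
    rw [chr, Finset.prod_eq_single i]
    · simp
    · intro j _ hj; simp [hj]
    · simp
  rw [this]
  refine chr_mem_trigSpan ?_
  rw [mem_freq, Finset.sum_eq_single i]
  · simpa using hk
  · intro j _ hj; simp [hj]
  · simp

theorem norm_geo_sq_coord_mem_trigSpan (q : ℕ) (i : Fin d) :
    (fun x : Fin d → ℝ => ((‖geo q (x i)‖ ^ 2 : ℝ) : ℂ)) ∈ trigSpan d (q - 1) := by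
  have : (fun x : Fin d → ℝ => ((‖geo q (x i)‖ ^ 2 : ℝ) : ℂ)) =
      ∑ n ∈ Finset.range q, ∑ j ∈ Finset.Icc (-(n : ℤ)) n,
        fun x : Fin d → ℝ => expPi j (x i) := by
    ext x
    rw [← sum_dirSum]
    simp [dirSum, Finset.sum_apply]
  rw [this]
  refine Submodule.sum_mem _ fun n hn => Submodule.sum_mem _ fun j hj => ?_
  refine expPi_coord_mem_trigSpan ?_ i
  rw [Finset.mem_range] at hn
  rw [Finset.mem_Icc] at hj
  rw [abs_le]
  omega

theorem integral_norm_geo_sq (q : ℕ) : ∫ t in (-1 : ℝ)..1, ‖geo q t‖ ^ 2 = 2 * q := by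
  have h : ∫ t in (-1 : ℝ)..1, ((‖geo q t‖ ^ 2 : ℝ) : ℂ) = 2 * q := by
    simp_rw [← sum_dirSum]
    rw [intervalIntegral.integral_finsetSum fun n _ =>
      (continuous_dirSum n).intervalIntegrable _ _]
    have : ∀ n, ∫ t in (-1 : ℝ)..1, dirSum n t = 2 := fun n => by
      simpa using integral_dirSum_mul n 0
    simp [this, mul_comm]
  rw [intervalIntegral.integral_ofReal] at h
  exact_mod_cast h

/-- The mass of `|G_q|⁴`. -/
def jacksonMass (q : ℕ) : ℝ := ∫ t in (-1 : ℝ)..1, ‖geo q t‖ ^ 4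

theorem norm_expPi_sub_one_le (k : ℤ) (t : ℝ) : ‖expPi k t - 1‖ ≤ |(k : ℝ)| * Real.pi * |t| := by
  rw [expPi, mul_comm]
  refine Real.norm_exp_I_mul_ofReal_sub_one_le.trans (le_of_eq ?_)
  rw [Real.norm_eq_abs, abs_mul, abs_mul, abs_of_pos Real.pi_pos]

/-- For `|t| ≤ 1/(8q)` every summand of `geo q t` is within `1/2` of `1`, so `‖geo q t‖ ≥ q/2` on an
interval of length `1/(4q)`. -/
theorem le_jacksonMass {q : ℕ} (hq : 0 < q) : (q : ℝ) ^ 3 / 64 ≤ jacksonMass q := by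
  have hq' : (1 : ℝ) ≤ q := by exact_mod_cast hq
  set a : ℝ := 1 / (8 * q) with ha
  have ha0 : 0 < a := by positivity
  have ha1 : a ≤ 1 := by rw [ha, div_le_one (by positivity)]; linarith
  have hqa : q * a = 1 / 8 := by rw [ha]; field_simp
  have hlow : ∀ t ∈ Set.Icc (-a) a, ((q : ℝ) / 2) ^ 4 ≤ ‖geo q t‖ ^ 4 := by
    intro t ht
    have ht' : |t| ≤ a := abs_le.2 ht
    have h1 : ‖geo q t - q‖ ≤ q / 2 := by
      have : geo q t - q = ∑ j ∈ Finset.range q, (expPi j t - 1) := by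
        simp [geo, Finset.sum_sub_distrib]
      rw [this]
      refine (norm_sum_le_of_le _ (n := fun _ => (1 / 2 : ℝ)) fun j hj => ?_).trans ?_
      · refine (norm_expPi_sub_one_le _ _).trans ?_
        have hj' : (j : ℝ) ≤ q := by exact_mod_cast (Finset.mem_range.1 hj).le
        have : |(((j : ℕ) : ℤ) : ℝ)| = j := by simp
        rw [this]
        calc (j : ℝ) * Real.pi * |t| ≤ q * 4 * a := by gcongr; exact Real.pi_le_four
          _ = 1 / 2 := by linarith
      · simp; linarith
    have h2 : (q : ℝ) - ‖geo q t‖ ≤ ‖geo q t - q‖ := by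
      rw [norm_sub_rev]
      have := norm_sub_norm_le (q : ℂ) (geo q t)
      rwa [Complex.norm_natCast] at this
    gcongr
    linarith
  have hc : Continuous fun t => ‖geo q t‖ ^ 4 := by fun_prop
  calc (q : ℝ) ^ 3 / 64 = ∫ t in (-a)..a, ((q : ℝ) / 2) ^ 4 := by
        rw [intervalIntegral.integral_const, smul_eq_mul]
        linear_combination (-(q : ℝ) ^ 3 / 8) * hqa
    _ ≤ ∫ t in (-a)..a, ‖geo q t‖ ^ 4 :=
        intervalIntegral.integral_mono_on (by linarith) (by simp) (hc.intervalIntegrable _ _) hlow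
    _ ≤ jacksonMass q :=
        intervalIntegral.integral_mono_interval (by linarith) (by linarith) ha1
          (.of_forall fun t => by positivity) (hc.intervalIntegrable _ _)

theorem jacksonMass_pos {q : ℕ} (hq : 0 < q) : 0 < jacksonMass q := by
  have : (0 : ℝ) < q := by exact_mod_cast hq
  exact lt_of_lt_of_le (by positivity) (le_jacksonMass hq)

/-- The normalized one-dimensional Jackson kernel. -/
def jackson₁ (q : ℕ) (t : ℝ) : ℝ := (jacksonMass q)⁻¹ * ‖geo q t‖ ^ 4

@[fun_prop] theorem continuous_jackson₁ (q : ℕ) : Continuous (jackson₁ q) := by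
  unfold jackson₁; fun_prop

theorem jackson₁_nonneg {q : ℕ} (hq : 0 < q) (t : ℝ) : 0 ≤ jackson₁ q t :=
  mul_nonneg (inv_nonneg.2 (jacksonMass_pos hq).le) (by positivity)

theorem integral_jackson₁ {q : ℕ} (hq : 0 < q) : ∫ t in (-1 : ℝ)..1, jackson₁ q t = 1 := by
  simp only [jackson₁]
  rw [intervalIntegral.integral_const_mul]
  exact inv_mul_cancel₀ (jacksonMass_pos hq).ne'

/-- One factor `‖geo‖` absorbs `|t|`, one is at most `q`, and the remaining square has integral
`2q`; the mass is at least `q³/64`. The fourth power is what avoids the logarithm of the Fejér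
kernel. -/
theorem integral_jackson₁_mul_abs_le {q : ℕ} (hq : 0 < q) :
    ∫ t in (-1 : ℝ)..1, jackson₁ q t * |t| ≤ 128 / q := by
  have hq' : (1 : ℝ) ≤ q := by exact_mod_cast hq
  have hm := jacksonMass_pos hq
  have h1 : ∀ t ∈ Set.Icc (-1 : ℝ) 1, jackson₁ q t * |t| ≤
      (jacksonMass q)⁻¹ * (q * ‖geo q t‖ ^ 2) := by
    intro t ht
    rw [jackson₁, mul_assoc]
    refine mul_le_mul_of_nonneg_left ?_ (inv_nonneg.2 hm.le)
    have h2 := norm_geo_mul_sinHalf_le q t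
    have h3 := abs_le_sinHalf (abs_le.2 ht)
    have h4 := norm_geo_le q t
    have h0 := norm_nonneg (geo q t)
    have h5 : ‖geo q t‖ * |t| ≤ 1 := (mul_le_mul_of_nonneg_left h3 h0).trans h2
    have h6 : ‖geo q t‖ * (‖geo q t‖ * |t|) ≤ q * 1 :=
      mul_le_mul h4 h5 (by positivity) (by linarith)
    calc ‖geo q t‖ ^ 4 * |t| = ‖geo q t‖ * (‖geo q t‖ * |t|) * ‖geo q t‖ ^ 2 := by ring
      _ ≤ q * 1 * ‖geo q t‖ ^ 2 := by gcongr
      _ = _ := by ring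
  calc _ ≤ ∫ t in (-1 : ℝ)..1, (jacksonMass q)⁻¹ * (q * ‖geo q t‖ ^ 2) :=
        intervalIntegral.integral_mono_on (by norm_num)
          (Continuous.intervalIntegrable (by fun_prop) _ _)
          (Continuous.intervalIntegrable (by fun_prop) _ _) h1
    _ = (jacksonMass q)⁻¹ * (2 * q ^ 2) := by
        rw [intervalIntegral.integral_const_mul, intervalIntegral.integral_const_mul,
          integral_norm_geo_sq]
        ring
    _ ≤ ((q : ℝ) ^ 3 / 64)⁻¹ * (2 * q ^ 2) := by
        have := le_jacksonMass hq
        gcongr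
    _ = 128 / q := by field_simp; norm_num

/-- The tensor product Jackson kernel. -/
def jackson (d q : ℕ) (y : Fin d → ℝ) : ℝ := ∏ i, jackson₁ q (y i)

theorem jackson_mem_trigPoly {q N : ℕ} (h : d * (2 * (q - 1)) ≤ N) :
    jackson d q ∈ trigPoly d N := by
  refine trigPoly_mono h (mem_trigPoly_iff.2 ?_)
  have h1 : ∀ i : Fin d, (fun x : Fin d → ℝ => (jackson₁ q (x i) : ℂ)) ∈
      trigSpan d (2 * (q - 1)) := fun i => by
    have h2 := mul_mem_trigSpan (norm_geo_sq_coord_mem_trigSpan q i)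
      (norm_geo_sq_coord_mem_trigSpan q i)
    rw [← two_mul] at h2
    convert Submodule.smul_mem _ (((jacksonMass q)⁻¹ : ℝ) : ℂ) h2 using 1
    ext x
    simp only [jackson₁, Pi.smul_apply, Pi.mul_apply, smul_eq_mul]
    push_cast; ring
  have h3 := prod_mem_trigSpan Finset.univ h1
  rw [Finset.card_univ, Fintype.card_fin] at h3
  convert h3 using 1
  ext x
  simp [jackson, Finset.prod_apply]

theorem continuous_jackson (d q : ℕ) : Continuous (jackson d q) := by
  unfold jackson; fun_prop

theorem integral_jackson {q : ℕ} (hq : 0 < q) : ∫ y in cube d, jackson d q y = 1 := by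
  simp only [jackson]
  rw [integral_cube_prod fun _ => jackson₁ q]
  simp [integral_jackson₁ hq]

theorem integral_jackson_mul_abs_le {q : ℕ} (hq : 0 < q) (i : Fin d) :
    ∫ y in cube d, jackson d q y * |y i| ≤ 128 / q := by
  have : ∀ y : Fin d → ℝ, jackson d q y * |y i| =
      ∏ j, jackson₁ q (y j) * (if j = i then |y j| else 1) := fun y => by
    rw [Finset.prod_mul_distrib, Finset.prod_ite_eq' Finset.univ i, if_pos (Finset.mem_univ i),
      jackson]
  simp_rw [this]
  rw [integral_cube_prod fun j t => jackson₁ q t * (if j = i then |t| else 1),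
    Finset.prod_eq_single i]
  · simpa using integral_jackson₁_mul_abs_le hq
  · intro j _ hj
    simpa [hj] using integral_jackson₁ hq
  · simp

/-! ### Jackson's theorem in terms of mixed differences -/

/-- The difference `g (x + h e_i) - g x` for `p = (i, h)`. -/
def diff (p : Fin d × ℝ) (g : (Fin d → ℝ) → ℝ) (x : Fin d → ℝ) : ℝ :=
  g (x + Pi.single p.1 p.2) - g x

/-- Iterated differences. -/
def diffs (l : List (Fin d × ℝ)) (g : (Fin d → ℝ) → ℝ) : (Fin d → ℝ) → ℝ := l.foldr diff g

/-- All mixed differences of order `r` are bounded by `M` times the product of the steps. -/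
def MixedBound (r : ℕ) (M : ℝ) (g : (Fin d → ℝ) → ℝ) : Prop :=
  ∀ l : List (Fin d × ℝ), l.length = r → ∀ x, |diffs l g x| ≤ (l.map fun p => |p.2|).prod * M

theorem MixedBound.diff {r : ℕ} {M : ℝ} {g : (Fin d → ℝ) → ℝ} (h : MixedBound (r + 1) M g)
    (p : Fin d × ℝ) : MixedBound r (|p.2| * M) (diff p g) := fun l hl x => by
  -- A right fold applies the last entry of the list to `g` first.
  have := h (l ++ [p]) (by simp [hl]) x
  simpa [diffs, mul_assoc] using this

/-- Walk from `x` to `x - y` one coordinate at a time. -/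
theorem abs_sub_le_of_diff_le {g : (Fin d → ℝ) → ℝ} {B : ℝ}
    (hg : ∀ p x, |diff p g x| ≤ |p.2| * B) (x y : Fin d → ℝ) :
    |g x - g (x - y)| ≤ (∑ i, |y i|) * B := by
  have key : ∀ S : Finset (Fin d),
      |g x - g (x - ∑ i ∈ S, Pi.single i (y i))| ≤ (∑ i ∈ S, |y i|) * B := by
    intro S
    induction S using Finset.induction_on with
    | empty => simp
    | insert i S hi ih =>
      rw [Finset.sum_insert hi, Finset.sum_insert hi]
      have h1 := hg (i, y i) (x - (Pi.single i (y i) + ∑ i ∈ S, Pi.single i (y i)))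
      rw [TrigApprox.diff] at h1
      dsimp only at h1
      rw [show x - (Pi.single i (y i) + ∑ i ∈ S, Pi.single i (y i)) + Pi.single i (y i) =
        x - ∑ i ∈ S, Pi.single i (y i) by abel] at h1
      have h2 := abs_add_le (g x - g (x - ∑ i ∈ S, Pi.single i (y i)))
        (g (x - ∑ i ∈ S, Pi.single i (y i)) -
          g (x - (Pi.single i (y i) + ∑ i ∈ S, Pi.single i (y i))))
      rw [sub_add_sub_cancel] at h2
      linarith
  have := key Finset.univ
  rwa [Finset.univ_sum_single] at this

/-- The residual `g - K * g`. -/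
def resid (K g : (Fin d → ℝ) → ℝ) (x : Fin d → ℝ) : ℝ := g x - circConv K g x

/-- As the kernel has mass one, the residual is its average of `g x - g (x - y)`, controlled by the
first moments in each coordinate. -/
theorem abs_resid_jackson_le {q : ℕ} (hq : 0 < q) {g : (Fin d → ℝ) → ℝ} (hc : Continuous g)
    {B : ℝ} (hg : ∀ p x, |diff p g x| ≤ |p.2| * B) (hB : 0 ≤ B) (x : Fin d → ℝ) :
    |resid (jackson d q) g x| ≤ 128 * d / q * B := by
  have hJ := continuous_jackson d q
  have h0 : ∀ y, 0 ≤ jackson d q y := fun y =>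
    Finset.prod_nonneg fun i _ => jackson₁_nonneg hq _
  have h1 : resid (jackson d q) g x = ∫ y in cube d, jackson d q y * (g x - g (x - y)) := by
    have : ∫ y in cube d, jackson d q y * g x = g x := by
      rw [integral_mul_const, integral_jackson hq, one_mul]
    rw [resid, circConv]
    simp_rw [mul_sub]
    rw [integral_sub (integrableOn_cube (by fun_prop)) (integrableOn_cube (by fun_prop)), this]
  rw [h1]
  calc |∫ y in cube d, jackson d q y * (g x - g (x - y))|
      ≤ ∫ y in cube d, ∑ i, jackson d q y * |y i| * B := by
        rw [← Real.norm_eq_abs]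
        refine norm_integral_le_of_norm_le (integrableOn_cube (by fun_prop))
          (.of_forall fun y => ?_)
        rw [norm_mul, Real.norm_of_nonneg (h0 y), Real.norm_eq_abs]
        refine (mul_le_mul_of_nonneg_left (abs_sub_le_of_diff_le hg x y) (h0 y)).trans
          (le_of_eq ?_)
        rw [Finset.sum_mul, Finset.mul_sum]
        exact Finset.sum_congr rfl fun i _ => by ring
    _ = ∑ i : Fin d, (∫ y in cube d, jackson d q y * |y i|) * B := by
        rw [integral_finsetSum _ fun i _ => integrableOn_cube (by fun_prop)]
        simp_rw [integral_mul_const]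
    _ ≤ ∑ i : Fin d, 128 / q * B := by
        gcongr with i _
        exact integral_jackson_mul_abs_le hq i
    _ = _ := by simp; ring

theorem diff_resid {K g : (Fin d → ℝ) → ℝ} (hK : Continuous K) (hg : Continuous g)
    (p : Fin d × ℝ) : diff p (resid K g) = resid K (diff p g) := by
  ext x
  have h1 : circConv K (diff p g) x =
      circConv K (fun x => g (x + Pi.single p.1 p.2)) x - circConv K g x :=
    circConv_sub hK (by fun_prop) hg x
  have h2 : circConv K (fun x => g (x + Pi.single p.1 p.2)) x =
      circConv K g (x + Pi.single p.1 p.2) := by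
    simp only [circConv]
    refine integral_congr_ae (.of_forall fun y => ?_)
    dsimp only
    congr 2; abel
  rw [diff, resid, resid, resid, h1, h2, diff]
  ring

theorem continuous_diff {g : (Fin d → ℝ) → ℝ} (hg : Continuous g) (p : Fin d × ℝ) :
    Continuous (diff p g) := by unfold diff; fun_prop

theorem periodic_diff {g : (Fin d → ℝ) → ℝ} (hg : IsPeriodic g) (p : Fin d × ℝ) :
    IsPeriodic (diff p g) := fun i x => by
  rw [diff, diff, hg, add_right_comm, hg]

/-- Each step subtracts a convolution with `K`, a member of `𝕋_N`. The accumulated difference is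
thus an approximant whose error is the iterated residual. -/
theorem iterate_resid_spec {N : ℕ} {K f : (Fin d → ℝ) → ℝ} (hK : K ∈ trigPoly d N)
    (hf : IsPeriodic f) (hc : Continuous f) (r : ℕ) :
    (fun x => f x - (resid K)^[r] f x) ∈ trigPoly d N ∧ IsPeriodic ((resid K)^[r] f) ∧
      Continuous ((resid K)^[r] f) := by
  induction r with
  | zero => exact ⟨by simpa using zero_mem_trigPoly N, hf, hc⟩
  | succ r ih =>
    obtain ⟨h1, h2, h3⟩ := ih
    have h4 := circConv_mem_trigPoly hK h2 h3
    have h5 := add_mem_trigPoly h1 h4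
    rw [Function.iterate_succ_apply']
    refine ⟨?_, ?_, ?_⟩
    · convert h5 using 2 with x
      rw [resid]; ring
    · intro i x
      rw [resid, resid, h2, periodic_of_mem_trigPoly h4]
    · exact h3.sub (continuous_of_mem_trigPoly h4)

theorem diff_iterate_resid {N : ℕ} {K f : (Fin d → ℝ) → ℝ} (hK : K ∈ trigPoly d N)
    (hf : IsPeriodic f) (hc : Continuous f) (r : ℕ) (p : Fin d × ℝ) :
    diff p ((resid K)^[r] f) = (resid K)^[r] (diff p f) := by
  induction r with
  | zero => rfl
  | succ r ih =>
    rw [Function.iterate_succ_apply', Function.iterate_succ_apply',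
      diff_resid (continuous_of_mem_trigPoly hK) (iterate_resid_spec hK hf hc r).2.2, ih]

/-- Every residual trades one difference for a factor `128 d / q`. Since differences commute with
residuals, the first differences of the `r`-th iterate are bounded by the induction hypothesis for
`diff p f`. -/
theorem abs_iterate_resid_jackson_le {q : ℕ} (hq : 0 < q) {r : ℕ} {M : ℝ} (hM : 0 ≤ M)
    {f : (Fin d → ℝ) → ℝ} (hf : IsPeriodic f) (hc : Continuous f) (h : MixedBound r M f)
    (x : Fin d → ℝ) : |(resid (jackson d q))^[r] f x| ≤ (128 * d / q) ^ r * M := by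
  have hK := jackson_mem_trigPoly (d := d) (q := q) le_rfl
  induction r generalizing f M x with
  | zero => simpa [diffs] using h [] rfl x
  | succ r ih =>
    rw [Function.iterate_succ_apply']
    refine (abs_resid_jackson_le hq (iterate_resid_spec hK hf hc r).2.2
      (B := (128 * d / q) ^ r * M) (fun p x => ?_) (by positivity) x).trans (le_of_eq (by ring))
    rw [diff_iterate_resid hK hf hc]
    refine (ih (M := |p.2| * M) (by positivity) (periodic_diff hf p) (continuous_diff hc p)
      (h.diff p) x).trans (le_of_eq (by ring))

/-- Jackson's inequality. -/
theorem bestApprox_le_of_mixedBound (hd : 0 < d) {n r : ℕ} (hn : 0 < n) {M : ℝ} (hM : 0 ≤ M)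
    {f : (Fin d → ℝ) → ℝ} (hf : IsPeriodic f) (hc : Continuous f) (h : MixedBound r M f) :
    bestApprox n f ≤ ENNReal.ofReal ((256 * d ^ 2 / n) ^ r * M) := by
  -- The largest `q` with `2d(q - 1) ≤ n`, the degree of the kernel; then `n ≤ 2dq`, which turns
  -- `128 d / q` into at most `256 d² / n`.
  set q := n / (2 * d) + 1 with hq
  have hq0 : 0 < q := Nat.succ_pos _
  have hdeg : d * (2 * (q - 1)) ≤ n := by
    rw [hq, Nat.add_sub_cancel, ← mul_assoc, mul_comm d 2]
    exact Nat.mul_div_le n (2 * d)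
  have ht := (iterate_resid_spec (jackson_mem_trigPoly hdeg) hf hc r).1
  refine (iInf₂_le _ ht).trans (supNorm_le_ofReal fun x => ?_)
  have h1 : f x - (resid (jackson d q))^[r] f x - f x = -(resid (jackson d q))^[r] f x := by ring
  rw [h1, abs_neg]
  refine (abs_iterate_resid_jackson_le hq0 hM hf hc h x).trans ?_
  have hd' : (0 : ℝ) < d := by exact_mod_cast hd
  have hn' : (0 : ℝ) < n := by exact_mod_cast hn
  have h2 : (n : ℝ) ≤ 2 * d * q := by
    have : n < 2 * d * (n / (2 * d) + 1) := Nat.lt_mul_div_succ n (by omega)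
    exact_mod_cast this.le
  have hq' : (0 : ℝ) < q := by exact_mod_cast hq0
  have h3 : (128 * d / q : ℝ) ≤ 256 * d ^ 2 / n := by
    rw [div_le_div_iff₀ hq' hn']
    nlinarith
  gcongr

/-! ### Mixed differences of functions in `C_p^{ν,1}` -/

theorem diff_comm (p q : Fin d × ℝ) (g : (Fin d → ℝ) → ℝ) :
    diff p (diff q g) = diff q (diff p g) := by
  ext x
  simp only [diff, add_right_comm x (Pi.single p.1 p.2)]
  ring

theorem diffs_perm {l l' : List (Fin d × ℝ)} (h : l.Perm l') (g : (Fin d → ℝ) → ℝ) :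
    diffs l g = diffs l' g :=
  h.foldr_eq' (fun p _ q _ g => diff_comm q p g) g

theorem diffs_append_singleton (l : List (Fin d × ℝ)) (p : Fin d × ℝ) (g : (Fin d → ℝ) → ℝ) :
    diffs (l ++ [p]) g = diff p (diffs l g) :=
  diffs_perm (l' := p :: l) (List.perm_append_singleton p l) g

/-- A Lipschitz function on `ℝ` whose derivative is almost everywhere at most `M`. -/
theorem abs_sub_le_of_lipschitzWith {C : ℝ≥0} {φ : ℝ → ℝ} (hφ : LipschitzWith C φ) {M : ℝ}
    (h : ∀ᵐ t, |deriv φ t| ≤ M) (a b : ℝ) : |φ b - φ a| ≤ M * |b - a| := by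
  have hac := (hφ.lipschitzOnWith (s := Set.uIcc a b)).absolutelyContinuousOnInterval
  rw [← hac.integral_deriv_eq_sub, ← Real.norm_eq_abs]
  refine intervalIntegral.norm_integral_le_of_norm_le_const_ae ?_
  filter_upwards [h] with t ht _ using ht

theorem deriv_comp_line (g : (Fin d → ℝ) → ℝ) (x v : Fin d → ℝ) (t : ℝ) :
    deriv (fun s : ℝ => g (x + s • v)) t = lineDeriv ℝ g (x + t • v) v := by
  rw [lineDeriv]
  have : (fun s : ℝ => g (x + t • v + s • v)) = fun s => (fun s => g (x + s • v)) (t + s) := by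
    ext s; dsimp only; rw [add_smul, add_assoc]
  rw [this, deriv_comp_const_add (fun s => g (x + s • v)) t 0, add_zero]

/-- An almost everywhere bound on a partial derivative of a Lipschitz function bounds its
difference quotients everywhere. -/
theorem abs_diff_le_of_lipschitzWith {C : ℝ≥0} {g : (Fin d → ℝ) → ℝ} (hg : LipschitzWith C g)
    {M : ℝ} {i : Fin d} (h : ∀ᵐ x, |partialDeriv i g x| ≤ M) (t : ℝ) (x : Fin d → ℝ) :
    |diff (i, t) g x| ≤ |t| * M := by
  set v : Fin d → ℝ := Pi.single i 1 with hv
  -- Fubini: for each fixed `s` the bound holds for almost every `x`, by translation invariance;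
  -- hence almost every line is good at almost every point.
  have hline : ∀ᵐ x : Fin d → ℝ, ∀ᵐ s : ℝ, |partialDeriv i g (x + s • v)| ≤ M := by
    have hmeas : MeasurableSet {x : Fin d → ℝ | |partialDeriv i g x| ≤ M} :=
      measurableSet_le (measurable_lineDeriv hg.continuous).abs measurable_const
    have hm2 : Measurable fun p : (Fin d → ℝ) × ℝ => p.1 + p.2 • v := by fun_prop
    rw [Measure.ae_ae_comm
      (p := fun (x : Fin d → ℝ) (s : ℝ) => |partialDeriv i g (x + s • v)| ≤ M) (hm2 hmeas)]
    refine .of_forall fun s => ?_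
    exact (measurePreserving_add_right volume (s • v)).quasiMeasurePreserving.ae h
  have hgood : ∀ᵐ x : Fin d → ℝ, |diff (i, t) g x| ≤ |t| * M := by
    filter_upwards [hline] with x hx
    have hL : LipschitzWith (C * ‖v‖₊) fun s : ℝ => g (x + s • v) := by
      refine hg.comp (LipschitzWith.of_dist_le_mul fun s s' => ?_)
      rw [dist_add_left, dist_eq_norm, ← sub_smul, norm_smul, dist_eq_norm, coe_nnnorm, mul_comm]
    have := abs_sub_le_of_lipschitzWith hL (M := M) (by
      filter_upwards [hx] with s hs
      rw [deriv_comp_line]; exact hs) 0 t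
    rw [sub_zero, zero_smul, add_zero] at this
    have e : t • v = Pi.single i t := by rw [hv, ← Pi.single_smul]; simp
    rw [e] at this
    rw [mul_comm]
    exact this
  -- A set of full measure is dense, and by continuity the inequality defines a closed set, so it
  -- holds everywhere.
  have hcl : IsClosed {x : Fin d → ℝ | |diff (i, t) g x| ≤ |t| * M} :=
    isClosed_le (continuous_diff hg.continuous _).abs continuous_const
  have := (Measure.dense_of_ae hgood).closure_eq
  rw [hcl.closure_eq] at this
  exact (Set.eq_univ_iff_forall.1 this) x

/-! ### Trading differences for partial derivatives. -/

theorem contDiff_partialDeriv {n : ℕ} {g : (Fin d → ℝ) → ℝ} (hg : ContDiff ℝ (n + 1 : ℕ) g)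
    (i : Fin d) : ContDiff ℝ n (partialDeriv i g) := by
  have h1 : partialDeriv i g = fun x => fderiv ℝ g x (Pi.single i 1) := by
    ext x
    exact ((hg.differentiable (by simp)) x).lineDeriv_eq_fderiv
  rw [h1]
  have h2 : ContDiff ℝ n (fderiv ℝ g) := hg.fderiv_right (by push_cast; exact le_rfl)
  exact h2.clm_apply contDiff_const

theorem hasLineDerivAt_diffs {g g' : (Fin d → ℝ) → ℝ} {v : Fin d → ℝ}
    (h : ∀ x, HasLineDerivAt ℝ g (g' x) x v) (l : List (Fin d × ℝ)) (x : Fin d → ℝ) :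
    HasLineDerivAt ℝ (diffs l g) (diffs l g' x) x v := by
  induction l generalizing x with
  | nil => exact h x
  | cons p l ih =>
    have h1 := ih (x + Pi.single p.1 p.2)
    have h2 := ih x
    unfold HasLineDerivAt at h1 h2 ⊢
    simp only [add_right_comm x (Pi.single p.1 p.2)] at h1
    exact h1.sub h2

theorem abs_diff_le_of_hasLineDerivAt {g g' : (Fin d → ℝ) → ℝ} {i : Fin d}
    (h : ∀ x, HasLineDerivAt ℝ g (g' x) x (Pi.single i 1)) {M : ℝ} (hM : ∀ x, |g' x| ≤ M)
    (t : ℝ) (x : Fin d → ℝ) : |diff (i, t) g x| ≤ |t| * M := by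
  set v : Fin d → ℝ := Pi.single i 1 with hv
  have hd : ∀ s : ℝ, HasDerivAt (fun s : ℝ => g (x + s • v)) (g' (x + s • v)) s := fun s => by
    have h1 := h (x + s • v)
    unfold HasLineDerivAt at h1
    have h2 := HasDerivAt.comp_sub_const (x := s) (a := s)
      (f := fun r : ℝ => g (x + s • v + r • v)) (by simpa using h1)
    have e : (fun r : ℝ => g (x + s • v + (r - s) • v)) = fun r => g (x + r • v) := by
      ext r
      rw [add_assoc, ← add_smul, add_sub_cancel]
    rwa [e] at h2
  have := Convex.norm_image_sub_le_of_norm_hasDerivWithin_le (s := Set.univ) (x := 0) (y := t)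
    (C := M) (fun s _ => (hd s).hasDerivWithinAt) (fun s _ => hM _) convex_univ
    (Set.mem_univ _) (Set.mem_univ _)
  have e : t • v = Pi.single i t := by rw [hv, ← Pi.single_smul]; simp
  rw [sub_zero, zero_smul, add_zero, e] at this
  rw [mul_comm]
  exact this

/-- Iterated partial derivatives along a list of directions. -/
def iterPartial (L : List (Fin d)) (f : (Fin d → ℝ) → ℝ) : (Fin d → ℝ) → ℝ :=
  L.foldr partialDeriv f

/-- Differences pass through derivatives, so the mean value theorem removes the differences of `l`
one by one, each costing one derivative of `g`. The difference `(i, t)` is left to the end because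
the last derivative reached need not be differentiable. -/
theorem abs_diffs_le_of_iterPartial (l : List (Fin d × ℝ)) {g : (Fin d → ℝ) → ℝ}
    (hg : ContDiff ℝ l.length g) {i : Fin d} {M : ℝ}
    (h : ∀ t x, |diff (i, t) (iterPartial (l.map Prod.fst) g) x| ≤ |t| * M)
    (t : ℝ) (x : Fin d → ℝ) :
    |diffs ((i, t) :: l) g x| ≤ (((i, t) :: l).map fun p => |p.2|).prod * M := by
  induction l using List.reverseRecOn generalizing g x with
  | nil => simpa [diffs, iterPartial] using h t x
  | append_singleton l p ih =>
    rw [List.length_append, List.length_singleton] at hg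
    have hg' := contDiff_partialDeriv hg p.1
    have h1 := ih hg' fun t x => by
      have := h t x
      simpa [iterPartial] using this
    have h2 := hasLineDerivAt_diffs (g := g) (g' := partialDeriv p.1 g) (fun x =>
      ((hg.differentiable (by simp)) x).lineDifferentiableAt.hasLineDerivAt) ((i, t) :: l)
    have h3 := abs_diff_le_of_hasLineDerivAt h2 h1 p.2 x
    rw [← List.cons_append, diffs_append_singleton]
    refine h3.trans (le_of_eq ?_)
    simp only [List.cons_append, List.map_cons, List.map_append, List.prod_cons, List.prod_append,
      List.map_nil, List.prod_nil]
    ring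

/-- A sorted list is the concatenation of its constant blocks, the order in which `multiDeriv`
composes; no symmetry of partial derivatives is used. -/
theorem iterPartial_eq_multiDeriv {L : List (Fin d)} (hL : L.Pairwise (· ≤ ·))
    (f : (Fin d → ℝ) → ℝ) : iterPartial L f = multiDeriv (fun i => L.count i) f := by
  have h1 : L = (List.finRange d).flatMap fun i => List.replicate (L.count i) i := by
    refine List.Perm.eq_of_pairwise' hL ?_ ?_
    · rw [List.pairwise_flatMap]
      refine ⟨fun i _ => List.pairwise_replicate.2 (.inr le_rfl), ?_⟩
      refine (List.pairwise_lt_finRange d).imp fun {i j} hij x hx y hy => ?_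
      rw [List.eq_of_mem_replicate hx, List.eq_of_mem_replicate hy]
      exact hij.le
    · rw [List.perm_iff_count]
      intro a
      rw [List.count_flatMap]
      have : (List.count a ∘ fun i => List.replicate (L.count i) i) =
          fun i => if i = a then L.count a else 0 := by
        ext i
        rw [Function.comp_apply, List.count_replicate]
        by_cases h : i = a <;> simp [h]
      rw [this, ← Fin.sum_univ_def, Finset.sum_ite_eq' Finset.univ a, if_pos (Finset.mem_univ a)]
  have h2 : ∀ (n : ℕ) (i : Fin d) (g : (Fin d → ℝ) → ℝ),
      (List.replicate n i).foldr partialDeriv g = (partialDeriv i)^[n] g := by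
    intro n i g
    induction n with
    | zero => rfl
    | succ n ih => rw [List.replicate_succ, List.foldr_cons, ih, Function.iterate_succ_apply']
  conv_lhs => rw [h1]
  rw [iterPartial, List.foldr_flatMap, multiDeriv]
  simp_rw [h2]

theorem sum_count_eq_length (L : List (Fin d)) : ∑ i, L.count i = L.length := by
  have := Multiset.sum_count_eq_card (s := Finset.univ) (m := (L : Multiset (Fin d)))
    fun a _ => Finset.mem_univ a
  simpa using this

theorem partialDeriv_periodic {g : (Fin d → ℝ) → ℝ} (hg : IsPeriodic g) (i : Fin d) :
    IsPeriodic (partialDeriv i g) := fun j x => by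
  rw [partialDeriv, partialDeriv, lineDeriv, lineDeriv]
  congr 1
  ext t
  rw [add_right_comm, hg]

theorem iterPartial_periodic {g : (Fin d → ℝ) → ℝ} (hg : IsPeriodic g) (L : List (Fin d)) :
    IsPeriodic (iterPartial L g) := by
  induction L with
  | nil => exact hg
  | cons i L ih => exact partialDeriv_periodic ih i

/-- The exceptional set is invariant under the period lattice, hence null as soon as it is null in
one fundamental domain. -/
theorem Periodic2.ae_of_ae_cube {g : (Fin d → ℝ) → ℝ} (hg : Periodic2 g) {p : ℝ → Prop}
    (h : ∀ᵐ x ∂(volume.restrict (cube d)), p (g x)) : ∀ᵐ x, p (g x) := by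
  rw [ae_iff]
  refine (isAddFundamentalDomain_translate (fun _ => -1)).measure_zero_of_invariant _ ?_ ?_
  · intro a
    ext x
    rw [Set.mem_vadd_set_iff_neg_vadd_mem, Set.mem_ofPred_eq, Set.mem_ofPred_eq, hg.add_period]
  · have h1 := (ae_restrict_iff' measurableSet_cube).1 h
    rw [ae_iff] at h1
    rw [measure_congr ((ae_eq_refl {x | ¬ p (g x)}).inter translate_fundamentalDomain_ae_eq_cube)]
    refine measure_mono_null (fun x hx => ?_) h1
    simp only [Set.mem_ofPred_eq, Classical.not_imp]
    exact ⟨hx.2, hx.1⟩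

/-- Mixed differences of order `ν + 1` of `f ∈ C_p^{ν,1}` are controlled by its norm. -/
theorem MemCp.mixedBound {ν : ℕ} {f : (Fin d → ℝ) → ℝ} (hf : MemCp ν f) :
    MixedBound (ν + 1) (cNorm ν f).toReal f := by
  intro l hl x
  -- Differences commute, so they may be sorted by direction. The derivatives then appear in the
  -- order of `multiDeriv`, and none need be interchanged at order `ν + 1`, where they exist only
  -- almost everywhere.
  let r : Fin d × ℝ → Fin d × ℝ → Prop := fun p q => p.1 ≤ q.1
  have : Std.Total r := ⟨fun p q => le_total p.1 q.1⟩
  have : IsTrans (Fin d × ℝ) r := ⟨fun p q s h1 h2 => le_trans (α := Fin d) h1 h2⟩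
  have hperm := List.perm_insertionSort r l
  have hsorted := List.pairwise_insertionSort r l
  rw [← diffs_perm hperm, ← (hperm.map fun p => |p.2|).prod_eq]
  have hlen := hperm.length_eq.trans hl
  generalize List.insertionSort r l = l' at hsorted hlen
  obtain _ | ⟨⟨i, t⟩, l'⟩ := l'
  · simp at hlen
  have hlen' : l'.length = ν := by simpa using hlen
  have hsort : (((i, t) :: l').map Prod.fst).Pairwise (· ≤ ·) := List.pairwise_map.2 hsorted
  have hsort' : (l'.map Prod.fst).Pairwise (· ≤ ·) := by
    rw [List.map_cons] at hsort
    exact hsort.of_cons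
  refine abs_diffs_le_of_iterPartial l' (by rw [hlen']; exact hf.contDiff) (fun s x => ?_) t x
  obtain ⟨C, hC⟩ := hf.lipschitz (fun j => (l'.map Prod.fst).count j) (by
    rw [sum_count_eq_length, List.length_map, hlen'])
  rw [← iterPartial_eq_multiDeriv hsort'] at hC
  refine abs_diff_le_of_lipschitzWith hC ?_ s x
  have hper := partialDeriv_periodic (iterPartial_periodic hf.periodic (l'.map Prod.fst)) i
  refine Periodic2.ae_of_ae_cube hper (p := fun y => |y| ≤ (cNorm ν f).toReal) ?_
  have hD : partialDeriv i (iterPartial (l'.map Prod.fst) f) =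
      multiDeriv (fun j => (((i, t) :: l').map Prod.fst).count j) f :=
    iterPartial_eq_multiDeriv (L := i :: l'.map Prod.fst) hsort f
  rw [hD]
  have hle : eLpNormEssSup (multiDeriv (fun j => (((i, t) :: l').map Prod.fst).count j) f)
      (volume.restrict (cube d)) ≤ cNorm ν f := by
    rw [← eLpNorm_exponent_top]
    exact le_iSup₂ (f := fun (α : Fin d → ℕ) (_ : ∑ i, α i ≤ ν + 1) =>
      eLpNorm (multiDeriv α f) ∞ (volume.restrict (cube d)))
      (fun j => (((i, t) :: l').map Prod.fst).count j) (by
        rw [sum_count_eq_length, List.length_map, hlen])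
  filter_upwards [enorm_ae_le_eLpNormEssSup
    (multiDeriv (fun j => (((i, t) :: l').map Prod.fst).count j) f)
    (volume.restrict (cube d))] with y hy
  rw [← Real.norm_eq_abs, ← toReal_enorm]
  exact ENNReal.toReal_mono hf.finite_norm.ne (hy.trans hle)

end TrigApprox

end

/-! ### The approximation theorem. -/

theorem mainTheorem3 (d : ℕ) (hd : 0 < d) :
    (∃ Λ : ℝ, ∀ N : ℕ, 0 < N → Even N →
      TrigApprox.l1Norm (TrigApprox.vpKernel d N) ≤ Λ) ∧
    ∀ ν : ℕ, ∃ K : ℝ, 0 < K ∧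
      ∀ Λ : ℝ, (∀ N : ℕ, 0 < N → Even N →
          TrigApprox.l1Norm (TrigApprox.vpKernel d N) ≤ Λ) →
        ∀ N : ℕ, 0 < N → Even N →
          ∀ f : (Fin d → ℝ) → ℝ, TrigApprox.MemCp ν f →
            TrigApprox.circConv (TrigApprox.vpKernel d N) f ∈ TrigApprox.trigPoly d N ∧
            TrigApprox.supNorm
                (fun x => f x - TrigApprox.circConv (TrigApprox.vpKernel d N) f x) ≤
              ENNReal.ofReal (2 * Λ) * TrigApprox.bestApprox (N / 2) f ∧
            ENNReal.ofReal (2 * Λ) * TrigApprox.bestApprox (N / 2) f ≤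
              ENNReal.ofReal (2 ^ (ν + 2) * Λ * K / (N : ℝ) ^ (ν + 1)) *
                TrigApprox.cNorm ν f := by
  -- Jackson's inequality at degree `N/2` has the factor `(256 d² / (N/2))^(ν+1)`, that is `2^(ν+1)
  -- K / N^(ν+1)` for this `K`; the prefactor `2Λ` supplies the last power of two.
  refine ⟨⟨_, fun N hN _ => TrigApprox.l1Norm_vpKernel_le hd hN⟩, fun ν =>
    ⟨(256 * (d : ℝ) ^ 2) ^ (ν + 1), by positivity, fun Λ hΛ N hN hE f hf => ?_⟩⟩
  have hc := hf.contDiff.continuous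
  have hK := TrigApprox.vpKernel_mem_trigPoly (d := d) N
  have hKc := TrigApprox.continuous_of_mem_trigPoly hK
  have hrep := fun t ht x => TrigApprox.circConv_vpKernel (d := d) hE (t := t) ht x
  have hΛ1 : 1 ≤ Λ := (TrigApprox.one_le_l1Norm hKc hrep).trans (hΛ N hN hE)
  refine ⟨TrigApprox.circConv_mem_trigPoly hK hf.periodic hc,
    TrigApprox.supNorm_sub_circConv_le hKc hrep (hΛ N hN hE) hf.periodic hc, ?_⟩
  obtain ⟨n, rfl⟩ := hE
  have hn : 0 < n := by omega
  have hn' : (0 : ℝ) < n := by exact_mod_cast hn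
  have hb := TrigApprox.bestApprox_le_of_mixedBound hd hn ENNReal.toReal_nonneg hf.periodic hc
    hf.mixedBound
  rw [show (n + n) / 2 = n by omega]
  calc _ ≤ ENNReal.ofReal (2 * Λ) * ENNReal.ofReal ((256 * d ^ 2 / n) ^ (ν + 1) *
        (TrigApprox.cNorm ν f).toReal) := by gcongr
    _ = ENNReal.ofReal (2 ^ (ν + 2) * Λ * (256 * (d : ℝ) ^ 2) ^ (ν + 1) /
          ((n + n : ℕ) : ℝ) ^ (ν + 1)) * ENNReal.ofReal (TrigApprox.cNorm ν f).toReal := by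
        rw [ENNReal.ofReal_mul (p := (256 * (d : ℝ) ^ 2 / n) ^ (ν + 1)) (by positivity), ← mul_assoc, ← ENNReal.ofReal_mul (by linarith)]
        congr 2
        push_cast
        rw [← two_mul, mul_pow, div_pow, pow_succ 2 (ν + 1)]
        field_simp
        rw [mul_pow 256, mul_pow 2]
        ring
    _ = _ := by rw [ENNReal.ofReal_toReal hf.finite_norm.ne]
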